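/- Let $y''=Q(x,y,y')$ be a second order ODE with $Q$ real and smooth on an open set $U$ of the first jet space with coordinates $(x,y,p)$. Put $D=\partial_x+p\,\partial_y+Q\,\partial_p$ and $$w_1=D^2Q_{pp}-4DQ_{py}-(DQ_{pp})Q_p+4Q_pQ_{py}-3Q_{pp}Q_y+6Q_{yy},\qquad w_2=Q_{pppp}.$$ Let $i\neq 0$ be a fixed real number, and let $P$ be the 8-dimensional manifold over $U$ with real coordinates $(x,y,p,\rho,\phi,\gamma,\bar\gamma,r)$, $\rho\ne0$ (a bar denotes an independent real quantity). With $\lambda=-i(dy-p\,dx)$, $\mu=dp-Q\,dx$, $\bar\mu=dx$, consider on $P$ the invariant forms of the point equivalence class of the ODE $$\theta^1=\rho e^{i\phi}(\mu+\gamma\lambda),\quad \theta^2=\rho e^{-i\phi}(\bar\mu+\bar\gamma\lambda),\quad \theta^3=\rho^2\lambda,$$ $$\Omega_2=i\,d\phi+\tfrac{d\rho}{\rho}+\tfrac{1}{4i\rho^2}\left[6\gamma\bar\gamma i^2-6\bar\gamma iQ_p-Q_{pp}-4ir\rho\right]\theta^3-\tfrac{2i\bar\gamma}{\rho}e^{-i\phi}\theta^1-\tfrac{e^{i\phi}}{\rho}(i\gamma-Q_p)\theta^2,$$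 $$\bar\Omega_2=-i\,d\phi+\tfrac{d\rho}{\rho}-\tfrac{1}{4i\rho^2}\left[6\gamma\bar\gamma i^2-2\bar\gamma iQ_p-Q_{pp}+4ir\rho\right]\theta^3+\tfrac{i\bar\gamma}{\rho}e^{-i\phi}\theta^1+\tfrac{e^{i\phi}}{\rho}(2i\gamma-Q_p)\theta^2,$$ put $\theta^4=\frac{1}{3i}(\Omega_2-\bar\Omega_2)$, and let $$\mathcal R=-\frac{e^{2i\phi}}{6i^2\rho^4}\,w_1,\qquad \bar{\mathcal R}=-\frac{e^{-2i\phi}}{6i^2\rho^4}\,w_2 .$$ The degenerate directions of the bilinear form $G=2\theta^1\theta^2+2\theta^3\theta^4$ are tangent to the fibres of $(x,y,p,\rho,\phi,\gamma,\bar\gamma,r)\mapsto(x,y,p,\phi)$. The Fefferman metrics $g_F$ of the ODE are the metrics $s^*G$ on open sets $V$ of the leaf space with coordinates $(x,y,p,\phi)$, for all smooth sections $s:V\to P$; they form the conformal class $[g_F]$. Let $V$ project onto $U$, and orient $V$ by $\theta^1\wedge\theta^2\wedge\theta^3\wedge\theta^4$. Below, the forms and functions on $P$ are pulled back by $s$.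 Then every $g_F$ has the following properties. (a) $g_F$ has signature $(++--)$. (b) The self-dual and anti-self-dual parts of its Weyl tensor (all indices lowered) are $$C^+=-\mathcal R\,(\theta^3\wedge\theta^2)\otimes(\theta^3\wedge\theta^2),\qquad C^-=-\bar{\mathcal R}\,(\theta^3\wedge\theta^1)\otimes(\theta^3\wedge\theta^1).$$ In particular $C^+$ is proportional to $\mathcal R$ (so to $w_1$) and $C^-$ is proportional to $\bar{\mathcal R}$ (so to $w_2$), and each of them is of Petrov type N (nonzero, with square zero as an operator on bivectors) wherever it does not vanish. Moreover, at each point of $P$, $\mathcal R=0$ if and only if $w_1=0$, and $\bar{\mathcal R}=0$ if and only if $w_2=0$. (c) Let $\tilde\omega$ be the Cartan normal conformal connection of $g_F$ and $\tilde\Omega=d\tilde\omega+\tilde\omega\wedge\tilde\omega=\tilde\Omega^++\tilde\Omega^-$ its curvature, decomposed into its self-dual and anti-self-dual parts. Then $g_F$ satisfies on $V$ the Baston–Mason conditions $$\text{(i)}\ \ d{*\tilde\Omega}+\tilde\omega\wedge{*\tilde\Omega}-{*\tilde\Omega}\wedge\tilde\omega=0\ \ (\text{the vanishing of the Bach tensor}),\qquad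 \text{(ii)}\ \ [\tilde\Omega^+_{\mu\nu},\tilde\Omega^-_{\rho\sigma}]=0$$ if and only if at each point of $P$ one has $\mathcal R=0$ or $\bar{\mathcal R}=0$. If $Q$ is real-analytic and $U$ is connected, or if each of $\mathcal R$, $\bar{\mathcal R}$ either vanishes identically or vanishes nowhere on $P$, this holds if and only if $\mathcal R\equiv0$ or $\bar{\mathcal R}\equiv0$ on $P$, that is, $w_1\equiv0$ or $w_2\equiv0$ on $U$. -/

import Mathlib

open scoped ContDiff

noncomputable section

namespace FeffermanODE

/-- The partial derivative `∂f/∂xᵘ` at `x`, for a real function on `ℝⁿ`. -/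
def pd {n : ℕ} (μ : Fin n) (f : (Fin n → ℝ) → ℝ) (x : Fin n → ℝ) : ℝ :=
  fderiv ℝ f x (Pi.single μ 1)

/-! ### The relative invariants of `y'' = Q(x, y, y')`

The first jet space has coordinates `u = (x, y, p)`, numbered `0, 1, 2`. -/

/-- The total derivative `D = ∂_x + p ∂_y + Q ∂_p`. -/
def totalD (Q f : (Fin 3 → ℝ) → ℝ) (u : Fin 3 → ℝ) : ℝ :=
  pd 0 f u + u 2 * pd 1 f u + Q u * pd 2 f u

/-- `w₁ = D²Q_pp - 4 DQ_py - (DQ_pp) Q_p + 4 Q_p Q_py - 3 Q_pp Q_y + 6 Q_yy`. -/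
def w₁ (Q : (Fin 3 → ℝ) → ℝ) (u : Fin 3 → ℝ) : ℝ :=
  totalD Q (totalD Q (pd 2 (pd 2 Q))) u - 4 * totalD Q (pd 1 (pd 2 Q)) u
    - totalD Q (pd 2 (pd 2 Q)) u * pd 2 Q u + 4 * pd 2 Q u * pd 1 (pd 2 Q) u
    - 3 * pd 2 (pd 2 Q) u * pd 1 Q u + 6 * pd 1 (pd 1 Q) u

/-- `w₂ = Q_pppp`. -/
def w₂ (Q : (Fin 3 → ℝ) → ℝ) (u : Fin 3 → ℝ) : ℝ :=
  pd 2 (pd 2 (pd 2 (pd 2 Q))) u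

/-! ### The bundle `P` of the equation

`P` is 8-dimensional, with coordinates `z = (x, y, p, ρ, φ, γ, γ̄, r)`, numbered `0, …, 7`. All the
quantities are real, a bar denotes an independent quantity, and `i` is a fixed nonzero real
number. -/

/-- The projection `P → J¹` onto the coordinates `(x, y, p)`. -/
def base (z : Fin 8 → ℝ) : Fin 3 → ℝ := ![z 0, z 1, z 2]

/-- The part of `P` over the domain `U` of the equation. -/
def bundle (U : Set (Fin 3 → ℝ)) : Set (Fin 8 → ℝ) := {z | base z ∈ U ∧ z 3 ≠ 0}

/-- The coordinate 1-forms on `P`. -/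
def dz (k : Fin 8) : (Fin 8 → ℝ) →L[ℝ] ℝ := ContinuousLinearMap.proj k

/-- `λ = -i (dy - p dx)`. -/
def formL (i : ℝ) (z : Fin 8 → ℝ) : (Fin 8 → ℝ) →L[ℝ] ℝ := (-i) • (dz 1 - z 2 • dz 0)

/-- `μ = dp - Q dx`. -/
def formM (Q : (Fin 3 → ℝ) → ℝ) (z : Fin 8 → ℝ) : (Fin 8 → ℝ) →L[ℝ] ℝ :=
  dz 2 - Q (base z) • dz 0

/-- `μ̄ = dx`. -/
def formMbar : (Fin 8 → ℝ) →L[ℝ] ℝ := dz 0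

/-- `θ¹ = ρ e^{iφ} (μ + γ λ)`. -/
def theta1 (i : ℝ) (Q : (Fin 3 → ℝ) → ℝ) (z : Fin 8 → ℝ) : (Fin 8 → ℝ) →L[ℝ] ℝ :=
  (z 3 * Real.exp (i * z 4)) • (formM Q z + z 5 • formL i z)

/-- `θ² = ρ e^{-iφ} (μ̄ + γ̄ λ)`. -/
def theta2 (i : ℝ) (z : Fin 8 → ℝ) : (Fin 8 → ℝ) →L[ℝ] ℝ :=
  (z 3 * Real.exp (-(i * z 4))) • (formMbar + z 6 • formL i z)

/-- `θ³ = ρ² λ`. -/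
def theta3 (i : ℝ) (z : Fin 8 → ℝ) : (Fin 8 → ℝ) →L[ℝ] ℝ := (z 3 ^ 2) • formL i z

/-- `Ω₂ = i dφ + dρ/ρ + (1/(4iρ²)) [6γγ̄i² - 6γ̄iQ_p - Q_pp - 4irρ] θ³
  - (2iγ̄/ρ) e^{-iφ} θ¹ - (e^{iφ}/ρ) (iγ - Q_p) θ²`. -/
def Omega2 (i : ℝ) (Q : (Fin 3 → ℝ) → ℝ) (z : Fin 8 → ℝ) : (Fin 8 → ℝ) →L[ℝ] ℝ :=
  i • dz 4 + (z 3)⁻¹ • dz 3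
    + (1 / (4 * i * z 3 ^ 2) * (6 * z 5 * z 6 * i ^ 2 - 6 * z 6 * i * pd 2 Q (base z)
        - pd 2 (pd 2 Q) (base z) - 4 * i * z 7 * z 3)) • theta3 i z
    - (2 * i * z 6 / z 3 * Real.exp (-(i * z 4))) • theta1 i Q z
    - (Real.exp (i * z 4) / z 3 * (i * z 5 - pd 2 Q (base z))) • theta2 i z

/-- `Ω̄₂ = -i dφ + dρ/ρ - (1/(4iρ²)) [6γγ̄i² - 2γ̄iQ_p - Q_pp + 4irρ] θ³
  + (iγ̄/ρ) e^{-iφ} θ¹ + (e^{iφ}/ρ) (2iγ - Q_p) θ²`. -/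
def Omega2bar (i : ℝ) (Q : (Fin 3 → ℝ) → ℝ) (z : Fin 8 → ℝ) : (Fin 8 → ℝ) →L[ℝ] ℝ :=
  (-i) • dz 4 + (z 3)⁻¹ • dz 3
    - (1 / (4 * i * z 3 ^ 2) * (6 * z 5 * z 6 * i ^ 2 - 2 * z 6 * i * pd 2 Q (base z)
        - pd 2 (pd 2 Q) (base z) + 4 * i * z 7 * z 3)) • theta3 i z
    + (i * z 6 / z 3 * Real.exp (-(i * z 4))) • theta1 i Q z
    + (Real.exp (i * z 4) / z 3 * (2 * i * z 5 - pd 2 Q (base z))) • theta2 i z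

/-- `θ⁴ = (1/(3i)) (Ω₂ - Ω̄₂)`. -/
def theta4 (i : ℝ) (Q : (Fin 3 → ℝ) → ℝ) (z : Fin 8 → ℝ) : (Fin 8 → ℝ) →L[ℝ] ℝ :=
  (1 / (3 * i)) • (Omega2 i Q z - Omega2bar i Q z)

/-- The forms `θ¹, θ², θ³, θ⁴` on `P`. -/
def tetrad (i : ℝ) (Q : (Fin 3 → ℝ) → ℝ) (z : Fin 8 → ℝ) : Fin 4 → ((Fin 8 → ℝ) →L[ℝ] ℝ) :=
  ![theta1 i Q z, theta2 i z, theta3 i z, theta4 i Q z]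

/-- The degenerate bilinear form `G = 2 θ¹ θ² + (2/(3i)) θ³ (Ω₂ - Ω̄₂)` on `P`
(symmetric products, `2 α β = α ⊗ β + β ⊗ α`). -/
def bilinG (i : ℝ) (Q : (Fin 3 → ℝ) → ℝ) (z v w : Fin 8 → ℝ) : ℝ :=
  theta1 i Q z v * theta2 i z w + theta2 i z v * theta1 i Q z w
    + (1 / (3 * i)) * (theta3 i z v * (Omega2 i Q z w - Omega2bar i Q z w)
      + (Omega2 i Q z v - Omega2bar i Q z v) * theta3 i z w)

/-- The curvature function `R = -(e^{2iφ}/(6 i² ρ⁴)) w₁` on `P`. -/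
def curvR (i : ℝ) (Q : (Fin 3 → ℝ) → ℝ) (z : Fin 8 → ℝ) : ℝ :=
  -(Real.exp (2 * i * z 4) / (6 * i ^ 2 * z 3 ^ 4)) * w₁ Q (base z)

/-- The curvature function `R̄ = -(e^{-2iφ}/(6 i² ρ⁴)) w₂` on `P`. -/
def curvRbar (i : ℝ) (Q : (Fin 3 → ℝ) → ℝ) (z : Fin 8 → ℝ) : ℝ :=
  -(Real.exp (-(2 * i * z 4)) / (6 * i ^ 2 * z 3 ^ 4)) * w₂ Q (base z)

/-! ### The leaf space and the Fefferman metrics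

The leaf space of the distribution of degenerate directions of `G` has the coordinates
`q = (x, y, p, φ)`, numbered `0, …, 3`. -/

/-- The projection `P → P/∼`, `(x, y, p, ρ, φ, γ, γ̄, r) ↦ (x, y, p, φ)`. -/
def leafProj (z : Fin 8 → ℝ) : Fin 4 → ℝ := ![z 0, z 1, z 2, z 4]

/-- The degenerate directions of `G` are exactly the vectors tangent to the fibres
of `leafProj`. -/
theorem bilinG_degenerate_iff (i : ℝ) (hi : i ≠ 0) (Q : (Fin 3 → ℝ) → ℝ) (z : Fin 8 → ℝ)
    (hz : z 3 ≠ 0) (v : Fin 8 → ℝ) : (∀ w, bilinG i Q z v w = 0) ↔ leafProj v = 0 := by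
  have he := Real.exp_ne_zero (i * z 4)
  have he' := Real.exp_ne_zero (-(i * z 4))
  constructor
  · intro h
    have h4 := h (Pi.single 4 1)
    have h2 := h (Pi.single 2 1)
    have h0 := h (Pi.single 0 1 + z 2 • Pi.single 1 1)
    have h1 := h (Pi.single 1 1)
    simp [bilinG, theta1, theta2, theta3, Omega2, Omega2bar, formL, formM, formMbar, dz,
      hz, hi] at h4
    have e1 : v 1 = z 2 * v 0 := by linarith
    simp [bilinG, theta1, theta2, theta3, Omega2, Omega2bar, formL, formM, formMbar, dz,
      hz, e1] at h2
    simp [bilinG, theta1, theta2, theta3, Omega2, Omega2bar, formL, formM, formMbar, dz,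
      hz, e1, h2] at h0
    simp [bilinG, theta1, theta2, theta3, Omega2, Omega2bar, formL, formM, formMbar, dz,
      hz, hi, e1, h2, h0] at h1
    funext k
    fin_cases k <;> simp [leafProj, e1, h2, h0, h1]
  · intro h
    have k0 : v 0 = 0 := by simpa [leafProj] using congrFun h 0
    have k1 : v 1 = 0 := by simpa [leafProj] using congrFun h 1
    have k2 : v 2 = 0 := by simpa [leafProj] using congrFun h 2
    have k4 : v 4 = 0 := by simpa [leafProj] using congrFun h 3
    intro w
    simp [bilinG, theta1, theta2, theta3, Omega2, Omega2bar, formL, formM, formMbar, dz,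
      k0, k1, k2, k4]

/-- `s` is a smooth section, over the open set `V` of the leaf space, of the projection from the
part of `P` over `U`, and `V` lies over all of `U`. -/
structure IsLeafSection (U : Set (Fin 3 → ℝ)) (V : Set (Fin 4 → ℝ))
    (s : (Fin 4 → ℝ) → (Fin 8 → ℝ)) : Prop where
  isOpen : IsOpen V
  smooth : ContDiffOn ℝ ∞ s V
  leafProj_eq : ∀ q ∈ V, leafProj (s q) = q
  mem_bundle : ∀ q ∈ V, s q ∈ bundle U
  surj : ∀ u ∈ U, ∃ q ∈ V, base (s q) = u

/-- The Fefferman metric `g_F = s^* G` on the leaf space, in the coordinates `(x, y, p, φ)`. The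
conformal class `[g_F]` consists of these metrics for all sections `s`. -/
def feffermanMetric (i : ℝ) (Q : (Fin 3 → ℝ) → ℝ) (s : (Fin 4 → ℝ) → (Fin 8 → ℝ))
    (q : Fin 4 → ℝ) : Matrix (Fin 4) (Fin 4) ℝ :=
  Matrix.of fun μ ν =>
    bilinG i Q (s q) (fderiv ℝ s q (Pi.single μ 1)) (fderiv ℝ s q (Pi.single ν 1))

/-- The components of the pulled back forms: row `a` is `s^* θ^(a+1)`. -/
def leafTetrad (i : ℝ) (Q : (Fin 3 → ℝ) → ℝ) (s : (Fin 4 → ℝ) → (Fin 8 → ℝ))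
    (q : Fin 4 → ℝ) : Matrix (Fin 4) (Fin 4) ℝ :=
  Matrix.of fun a μ => tetrad i Q (s q) a (fderiv ℝ s q (Pi.single μ 1))

/-- The sign, in the coordinates `(x, y, p, φ)`, of the orientation given by
`θ¹ ∧ θ² ∧ θ³ ∧ θ⁴`. -/
def leafOrientation (i : ℝ) (Q : (Fin 3 → ℝ) → ℝ) (s : (Fin 4 → ℝ) → (Fin 8 → ℝ))
    (q : Fin 4 → ℝ) : ℝ :=
  Real.sign (leafTetrad i Q s q).det

/-- The components of `α ∧ β = α ⊗ β - β ⊗ α`. -/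
def wedge (α β : Fin 4 → ℝ) (μ ν : Fin 4) : ℝ := α μ * β ν - α ν * β μ

/-! ### Curvature of a metric on (an open set of) `ℝ⁴`, in coordinates

In this part `g` is a matrix function of the coordinates, symmetric and invertible where it is
used, and `o` is a function with values `± 1` that gives the orientation. -/

/-- `Γ^a_{bc}`. -/
def christoffel (g : (Fin 4 → ℝ) → Matrix (Fin 4) (Fin 4) ℝ) (a b c : Fin 4)
    (x : Fin 4 → ℝ) : ℝ :=
  (1 / 2) * ∑ e, (g x)⁻¹ a e *
    (pd b (fun y => g y e c) x + pd c (fun y => g y e b) x - pd e (fun y => g y b c) x)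

/-- `R^a_{bcd} = ∂_c Γ^a_{db} - ∂_d Γ^a_{cb} + Γ^a_{ce} Γ^e_{db} - Γ^a_{de} Γ^e_{cb}`. -/
def riemann (g : (Fin 4 → ℝ) → Matrix (Fin 4) (Fin 4) ℝ) (a b c d : Fin 4)
    (x : Fin 4 → ℝ) : ℝ :=
  pd c (christoffel g a d b) x - pd d (christoffel g a c b) x
    + ∑ e, (christoffel g a c e x * christoffel g e d b x
      - christoffel g a d e x * christoffel g e c b x)

/-- `R_{bd} = R^a_{bad}`. -/
def ricci (g : (Fin 4 → ℝ) → Matrix (Fin 4) (Fin 4) ℝ) (b d : Fin 4) (x : Fin 4 → ℝ) : ℝ :=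
  ∑ a, riemann g a b a d x

/-- The scalar curvature. -/
def scalarCurv (g : (Fin 4 → ℝ) → Matrix (Fin 4) (Fin 4) ℝ) (x : Fin 4 → ℝ) : ℝ :=
  ∑ b, ∑ d, (g x)⁻¹ b d * ricci g b d x

/-- The Schouten tensor `P_{ab} = (R_{ab} - (R/6) g_{ab}) / 2`. -/
def schouten (g : (Fin 4 → ℝ) → Matrix (Fin 4) (Fin 4) ℝ) (a b : Fin 4) (x : Fin 4 → ℝ) : ℝ :=
  (1 / 2) * (ricci g a b x - scalarCurv g x / 6 * g x a b)

/-- The Weyl tensor `C_{abcd}`, all indices lowered. -/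
def weyl (g : (Fin 4 → ℝ) → Matrix (Fin 4) (Fin 4) ℝ) (x : Fin 4 → ℝ) (a b c d : Fin 4) : ℝ :=
  ∑ e, g x a e * riemann g e b c d x
    - (g x a c * schouten g b d x - g x a d * schouten g b c x
      + g x b d * schouten g a c x - g x b c * schouten g a d x)

/-- The alternating symbol. -/
def altSymbol (a b c d : Fin 4) : ℝ :=
  (Matrix.of fun j k : Fin 4 => if ![a, b, c, d] j = k then (1 : ℝ) else 0).det

/-- The Hodge dual of a 2-form, `(*F)_{ab} = (1/2) η_{abcd} F^{cd}`, where `η` is the volume form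
of `g` for the orientation `o`. -/
def hodge (o : (Fin 4 → ℝ) → ℝ) (g : (Fin 4 → ℝ) → Matrix (Fin 4) (Fin 4) ℝ) (x : Fin 4 → ℝ)
    (F : Fin 4 → Fin 4 → ℝ) (a b : Fin 4) : ℝ :=
  (1 / 2) * ∑ c, ∑ d, o x * Real.sqrt |(g x).det| * altSymbol a b c d *
    ∑ e, ∑ f, (g x)⁻¹ c e * (g x)⁻¹ d f * F e f

/-- The self-dual part of the Weyl tensor. -/
def weylPlus (o : (Fin 4 → ℝ) → ℝ) (g : (Fin 4 → ℝ) → Matrix (Fin 4) (Fin 4) ℝ)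
    (x : Fin 4 → ℝ) (a b c d : Fin 4) : ℝ :=
  (1 / 2) * (weyl g x a b c d + hodge o g x (weyl g x a b) c d)

/-- The anti-self-dual part of the Weyl tensor. -/
def weylMinus (o : (Fin 4 → ℝ) → ℝ) (g : (Fin 4 → ℝ) → Matrix (Fin 4) (Fin 4) ℝ)
    (x : Fin 4 → ℝ) (a b c d : Fin 4) : ℝ :=
  (1 / 2) * (weyl g x a b c d - hodge o g x (weyl g x a b) c d)

/-- Petrov type N for the self-dual or the anti-self-dual part `W_{abcd}` of a Weyl tensor, at a
point with metric `h`: as an operator on bivectors, `W` is nonzero and nilpotent with square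
zero. -/
def IsTypeN (h : Matrix (Fin 4) (Fin 4) ℝ) (W : Fin 4 → Fin 4 → Fin 4 → Fin 4 → ℝ) : Prop :=
  W ≠ 0 ∧ ∀ a b c d, ∑ e, ∑ f, ∑ k, ∑ l, W a b e f * h⁻¹ e k * h⁻¹ f l * W k l c d = 0

/-! ### The normal conformal connection and the Baston–Mason conditions -/

/-- The index set `{0} ∪ {1, 2, 3, 4} ∪ {5}` of the `6 × 6` matrices. -/
abbrev ConfIdx : Type := Unit ⊕ (Fin 4 ⊕ Unit)

/-- The component along `dx^μ` of Cartan's normal conformal connection of `g`, in the coordinate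
frame:
`ω̃ = [[0, -P_b, 0], [dx^a, Γ^a_b, -P^a], [0, g_{bc} dx^c, 0]]`, with `Γ^a_b` the Levi-Civita
connection forms and `P_b = P_{bc} dx^c` the Schouten forms. -/
def confConn (g : (Fin 4 → ℝ) → Matrix (Fin 4) (Fin 4) ℝ) (μ : Fin 4) (x : Fin 4 → ℝ) :
    Matrix ConfIdx ConfIdx ℝ :=
  Matrix.of fun A B => match A, B with
    | .inl _, .inr (.inl b) => -schouten g b μ x
    | .inr (.inl a), .inl _ => if a = μ then 1 else 0
    | .inr (.inl a), .inr (.inl b) => christoffel g a μ b x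
    | .inr (.inl a), .inr (.inr _) => -∑ c, (g x)⁻¹ a c * schouten g c μ x
    | .inr (.inr _), .inr (.inl b) => g x b μ
    | _, _ => 0

/-- The entrywise partial derivative of a matrix of functions. -/
def pdMat (μ : Fin 4) (M : (Fin 4 → ℝ) → Matrix ConfIdx ConfIdx ℝ) (x : Fin 4 → ℝ) :
    Matrix ConfIdx ConfIdx ℝ :=
  Matrix.of fun A B => pd μ (fun y => M y A B) x

/-- The components `Ω̃_{μν}` of the curvature `Ω̃ = dω̃ + ω̃ ∧ ω̃`. -/
def confCurv (g : (Fin 4 → ℝ) → Matrix (Fin 4) (Fin 4) ℝ) (μ ν : Fin 4) (x : Fin 4 → ℝ) :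
    Matrix ConfIdx ConfIdx ℝ :=
  pdMat μ (confConn g ν) x - pdMat ν (confConn g μ) x
    + (confConn g μ x * confConn g ν x - confConn g ν x * confConn g μ x)

/-- The components `(*Ω̃)_{μν}`. -/
def confCurvDual (o : (Fin 4 → ℝ) → ℝ) (g : (Fin 4 → ℝ) → Matrix (Fin 4) (Fin 4) ℝ)
    (μ ν : Fin 4) (x : Fin 4 → ℝ) : Matrix ConfIdx ConfIdx ℝ :=
  Matrix.of fun A B => hodge o g x (fun κ l => confCurv g κ l x A B) μ ν

/-- `Ω̃⁺_{μν}`. -/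
def confCurvPlus (o : (Fin 4 → ℝ) → ℝ) (g : (Fin 4 → ℝ) → Matrix (Fin 4) (Fin 4) ℝ)
    (μ ν : Fin 4) (x : Fin 4 → ℝ) : Matrix ConfIdx ConfIdx ℝ :=
  (1 / 2 : ℝ) • (confCurv g μ ν x + confCurvDual o g μ ν x)

/-- `Ω̃⁻_{μν}`. -/
def confCurvMinus (o : (Fin 4 → ℝ) → ℝ) (g : (Fin 4 → ℝ) → Matrix (Fin 4) (Fin 4) ℝ)
    (μ ν : Fin 4) (x : Fin 4 → ℝ) : Matrix ConfIdx ConfIdx ℝ :=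
  (1 / 2 : ℝ) • (confCurv g μ ν x - confCurvDual o g μ ν x)

/-- One term `∂_κ (*Ω̃)_{μν} + ω̃_κ (*Ω̃)_{μν} - (*Ω̃)_{μν} ω̃_κ` of the next definition. -/
def yangMillsTerm (o : (Fin 4 → ℝ) → ℝ) (g : (Fin 4 → ℝ) → Matrix (Fin 4) (Fin 4) ℝ)
    (κ μ ν : Fin 4) (x : Fin 4 → ℝ) : Matrix ConfIdx ConfIdx ℝ :=
  pdMat κ (confCurvDual o g μ ν) x
    + (confConn g κ x * confCurvDual o g μ ν x - confCurvDual o g μ ν x * confConn g κ x)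

/-- The `κμν` component of the matrix valued 3-form `d*Ω̃ + ω̃ ∧ *Ω̃ - *Ω̃ ∧ ω̃`. -/
def yangMills (o : (Fin 4 → ℝ) → ℝ) (g : (Fin 4 → ℝ) → Matrix (Fin 4) (Fin 4) ℝ)
    (κ μ ν : Fin 4) (x : Fin 4 → ℝ) : Matrix ConfIdx ConfIdx ℝ :=
  yangMillsTerm o g κ μ ν x + yangMillsTerm o g μ ν κ x + yangMillsTerm o g ν κ μ x

/-- The Baston–Mason conditions on `V`: (i) `d*Ω̃ + ω̃ ∧ *Ω̃ - *Ω̃ ∧ ω̃ = 0` (the vanishing of the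
Bach tensor) and (ii) `[Ω̃⁺_{μν}, Ω̃⁻_{κl}] = 0`. -/
structure BastonMason (o : (Fin 4 → ℝ) → ℝ) (g : (Fin 4 → ℝ) → Matrix (Fin 4) (Fin 4) ℝ)
    (V : Set (Fin 4 → ℝ)) : Prop where
  yangMills_eq_zero : ∀ x ∈ V, ∀ κ μ ν, yangMills o g κ μ ν x = 0
  commutator_eq_zero : ∀ x ∈ V, ∀ μ ν κ l,
    confCurvPlus o g μ ν x * confCurvMinus o g κ l x
      - confCurvMinus o g κ l x * confCurvPlus o g μ ν x = 0

end FeffermanODE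

end

open FeffermanODE

/-!
The metric depends on the section `s` only through the conformal factor: in the coordinates
`(x, y, p, φ)` it is `ρ² (m e + e m + 2 (k β + β k))` with `m = dp - Q dx`, `e = dx`,
`k = dy - p dx` and `β = c dφ + α`, where `c = -i/3` and `α` is the diagonal entry of the
`𝔰𝔩(3)`-valued Cartan connection `ω` of the equation (`bilinG_eq`, `ContactFrame.conn`).

The normal conformal connection of this metric comes from `ω`. On the rank 6 bundle
`ℝ³ ⊕ (ℝ³)*`, whose metric is minus the pairing of the two summands, `ω + c dφ` acts as a metric
connection. The first vector of `LeafFrame.frame`, an incident pair of a vector and a covector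
scaled by `ρ`, is null; its covariant derivatives have the Fefferman metric as their Gram matrix,
and together with a complementary null vector they form a frame. A metric connection in such a
frame is Cartan's normal conformal connection as soon as its curvature annihilates the first
vector and has no Ricci contraction, because it is then forced to consist of the Christoffel
symbols and the Schouten tensor (`ConfFrame.confConn_eq`). Both conditions are seen from the
curvature of `ω`, which is `k ∧ e` times a strictly upper triangular matrix with entries `w₁/6` and
`∂_p w₁/6`, plus `m ∧ k` times one with entries `w₂/6` and a combination of `w₂` and `D w₂`
(`ContactFrame.curvature_conn`).

All the claims can be read off from this. The 2-forms `k ∧ e` and `m ∧ k` are multiples of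
`θ³ ∧ θ²` and `θ³ ∧ θ¹`, so they are self-dual and anti-self-dual, and the Weyl tensor is the sum
of their squares with the coefficients `ρ² w₁/6` and `ρ² w₂/6`; each square is of type N since the
2-form is simple and null. As `3 × 3` matrices, the two parts of the curvature have a commutator
with a single entry, which is `w₁ w₂/36` times the product of the components of `k ∧ e` and `m ∧ k`.
The covariant exterior derivative of the dual curvature has a single entry too, a multiple of
`∂_p² w₁`, and a Bianchi identity expresses `∂_p² w₁` linearly in `w₂`, `D w₂` and `D² w₂`
(`ContactFrame.bianchi`). If `w₁ w₂ = 0`, then differentiation gives `∂_p² w₁ · w₂ = 0`, then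
`∂_p² w₁ · D w₂ = 0` and `∂_p² w₁ · D² w₂ = 0`, whence `(∂_p² w₁)² = 0`. So the second Baston–Mason
condition alone is equivalent to `w₁ w₂ = 0`, and it implies the first one. For analytic functions
on a connected open set, `w₁ w₂ = 0` makes one of the factors vanish.

The calculations are carried out in commutative rings with derivations, to which the algebras
`smoothAlg` of smooth functions are then specialized.
-/

noncomputable section

namespace FeffermanODE

open TopologicalSpace Matrix

/-! ### The differential ring of smooth functions on an open set -/

/-- The algebra of smooth real functions on the open set `V`, as functions on the subtype. Its
elements determine their partial derivatives, so that identities between derivatives can be proved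
by algebra in a ring with commuting derivations. -/
def smoothAlg {n : ℕ} (V : Opens (Fin n → ℝ)) : Subalgebra ℝ (V → ℝ) where
  carrier := {f | ∃ F : (Fin n → ℝ) → ℝ, ContDiffOn ℝ ∞ F V ∧ ∀ x : V, f x = F x}
  mul_mem' := by
    rintro f g ⟨F, hF, hf⟩ ⟨G, hG, hg⟩
    exact ⟨fun x => F x * G x, hF.mul hG, fun x => by simp [hf, hg]⟩
  add_mem' := by
    rintro f g ⟨F, hF, hf⟩ ⟨G, hG, hg⟩
    exact ⟨fun x => F x + G x, hF.add hG, fun x => by simp [hf, hg]⟩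
  algebraMap_mem' r := ⟨fun _ => r, contDiffOn_const, fun _ => rfl⟩

namespace smoothAlg

variable {n : ℕ} {V : Opens (Fin n → ℝ)}

/-- A function that is smooth on `V`, as an element of `smoothAlg V`. -/
def mk (F : (Fin n → ℝ) → ℝ) (hF : ContDiffOn ℝ ∞ F V) : smoothAlg V :=
  ⟨fun x => F x, F, hF, fun _ => rfl⟩

@[ext] lemma ext {f g : smoothAlg V} (h : ∀ x, f.1 x = g.1 x) : f = g :=
  Subtype.ext (funext h)

/-- An extension of `f` to a function on all of `ℝⁿ`; only its values on `V` are meaningful. -/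
def rep (f : smoothAlg V) : (Fin n → ℝ) → ℝ := f.2.choose

lemma contDiffOn_rep (f : smoothAlg V) : ContDiffOn ℝ ∞ (rep f) V := f.2.choose_spec.1

lemma rep_apply (f : smoothAlg V) (x : V) : rep f x = f.1 x := (f.2.choose_spec.2 x).symm

lemma pd_congr {W : Set (Fin n → ℝ)} (hW : IsOpen W) {F G : (Fin n → ℝ) → ℝ}
    (h : ∀ x ∈ W, F x = G x) (μ : Fin n) {x : Fin n → ℝ} (hx : x ∈ W) : pd μ F x = pd μ G x := by
  have : F =ᶠ[nhds x] G := Filter.eventuallyEq_of_mem (hW.mem_nhds hx) h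
  simp only [pd, this.fderiv_eq]

lemma contDiffOn_pd {W : Set (Fin n → ℝ)} (hW : IsOpen W) {F : (Fin n → ℝ) → ℝ}
    (hF : ContDiffOn ℝ ∞ F W) (μ : Fin n) : ContDiffOn ℝ ∞ (pd μ F) W :=
  (hF.fderiv_of_isOpen hW (by simp)).clm_apply contDiffOn_const

lemma differentiableAt_rep (f : smoothAlg V) (x : V) : DifferentiableAt ℝ (rep f) x :=
  ((contDiffOn_rep f).contDiffAt (V.isOpen.mem_nhds x.2)).differentiableAt (by simp)

/-- The partial derivative `∂/∂xᵘ` as a derivation of the algebra of smooth functions. -/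
def pder (μ : Fin n) : Derivation ℝ (smoothAlg V) (smoothAlg V) :=
  Derivation.mk'
    { toFun := fun f => mk (pd μ (rep f)) (contDiffOn_pd V.isOpen (contDiffOn_rep f) μ)
      map_add' := fun f g => by
        ext x
        have h : pd μ (rep (f + g)) x = pd μ (fun y => rep f y + rep g y) x :=
          pd_congr V.isOpen (fun y hy => by
            rw [rep_apply _ ⟨y, hy⟩, rep_apply _ ⟨y, hy⟩, rep_apply _ ⟨y, hy⟩]; rfl) μ x.2
        change pd μ (rep (f + g)) x = pd μ (rep f) x + pd μ (rep g) x
        rw [h]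
        simp only [pd]
        rw [fderiv_fun_add (differentiableAt_rep f x) (differentiableAt_rep g x)]
        rfl
      map_smul' := fun r f => by
        ext x
        have h : pd μ (rep (r • f)) x = pd μ (fun y => r • rep f y) x :=
          pd_congr V.isOpen (fun y hy => by
            rw [rep_apply _ ⟨y, hy⟩, rep_apply _ ⟨y, hy⟩]; rfl) μ x.2
        change pd μ (rep (r • f)) x = r • pd μ (rep f) x
        rw [h]
        simp only [pd]
        rw [fderiv_fun_const_smul (differentiableAt_rep f x)]
        rfl }
    (fun f g => by
      ext x
      have h : pd μ (rep (f * g)) x = pd μ (fun y => rep f y * rep g y) x :=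
        pd_congr V.isOpen (fun y hy => by
          rw [rep_apply _ ⟨y, hy⟩, rep_apply _ ⟨y, hy⟩, rep_apply _ ⟨y, hy⟩]; rfl) μ x.2
      change pd μ (rep (f * g)) x = f.1 x * pd μ (rep g) x + g.1 x * pd μ (rep f) x
      rw [h]
      simp only [pd]
      rw [fderiv_fun_mul (differentiableAt_rep f x) (differentiableAt_rep g x),
        rep_apply, rep_apply]
      rfl)

lemma pder_apply (μ : Fin n) (f : smoothAlg V) {F : (Fin n → ℝ) → ℝ}
    (h : ∀ x : V, f.1 x = F x) (x : V) : (pder μ f).1 x = pd μ F x :=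
  pd_congr V.isOpen (fun y hy => (rep_apply f ⟨y, hy⟩).trans (h ⟨y, hy⟩)) μ x.2

lemma pder_comm (μ ν : Fin n) (f : smoothAlg V) : pder μ (pder ν f) = pder ν (pder μ f) := by
  ext x
  have key : ∀ μ ν : Fin n, (pder μ (pder ν f)).1 x =
      fderiv ℝ (fderiv ℝ (rep f)) x (Pi.single μ 1) (Pi.single ν 1) := by
    intro μ ν
    rw [pder_apply μ (pder ν f) (F := pd ν (rep f)) (fun y => rfl)]
    have hd : DifferentiableAt ℝ (fderiv ℝ (rep f)) x :=
      (((contDiffOn_rep f).contDiffAt (V.isOpen.mem_nhds x.2)).fderiv_right (m := 1)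
        (by norm_cast)).differentiableAt (by simp)
    unfold pd
    rw [fderiv_clm_apply hd (differentiableAt_const _)]
    simp
  rw [key, key]
  have hs := ((contDiffOn_rep f).contDiffAt (V.isOpen.mem_nhds x.2)).isSymmSndFDerivAt
    (n := ∞) (by simp [minSmoothness_of_isRCLikeNormedField]; norm_cast)
  exact hs _ _

lemma isUnit_of_ne_zero (f : smoothAlg V) (h : ∀ x, f.1 x ≠ 0) : IsUnit f := by
  refine IsUnit.of_mul_eq_one (mk (fun y => (rep f y)⁻¹) ((contDiffOn_rep f).inv fun y hy => ?_)) ?_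
  · rw [rep_apply f ⟨y, hy⟩]; exact h _
  · ext x
    change f.1 x * (rep f x)⁻¹ = 1
    rw [rep_apply, mul_inv_cancel₀ (h x)]

/-- Evaluation at a point. -/
def eval (x : V) : smoothAlg V →ₐ[ℝ] ℝ :=
  (Pi.evalAlgHom ℝ (fun _ : V => ℝ) x).comp (smoothAlg V).val

lemma eval_apply (x : V) (f : smoothAlg V) : eval x f = f.1 x := rfl

/-- A vanishing product of two functions is still zero after one of them is differentiated. -/
lemma derivation_mul_eq_zero (X : Derivation ℝ (smoothAlg V) (smoothAlg V)) {f g : smoothAlg V}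
    (h : f * g = 0) : X f * g = 0 := by
  have h1 : f * X g + g * X f = 0 := by
    rw [← smul_eq_mul, ← smul_eq_mul g, ← X.leibniz, h, map_zero]
  -- the square of `X f * g` is `-(f * g) * X f * X g`, and the ring is reduced
  have h2 : (X f * g) * (X f * g) = 0 := by linear_combination X f * g * h1 - X f * X g * h
  ext x
  have h3 := congrArg (fun k : smoothAlg V => k.1 x) h2
  exact mul_self_eq_zero.1 h3

end smoothAlg

/-! ### The Cartan connection of the equation -/

/-- The differential algebra of the equation `y'' = Q`, `Q = 12 q`. In `S`, thought of as the smooth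
functions on the first jet space, `P = ∂_p`, `D = ∂_x + p ∂_y + Q ∂_p` and `Y = ∂_y`; in `R`, the
smooth functions on the leaf space, `m = dp - Q dx`, `e = dx` and `k = dy - p dx` are 1-forms given
by their components, and `d κ` are the partial derivatives. The factor `12` clears the denominators
of the Cartan connection. -/
structure ContactFrame (S R : Type*) [CommRing S] [Algebra ℝ S] [CommRing R] [Algebra ℝ R] where
  q : S
  P : Derivation ℝ S S
  D : Derivation ℝ S S
  Y : Derivation ℝ S S
  P_Y : ∀ f, P (Y f) = Y (P f)
  P_D : ∀ f, P (D f) = D (P f) + Y f + 12 * P q * P f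
  Y_D : ∀ f, Y (D f) = D (Y f) + 12 * Y q * P f
  π : S →+* R
  d : Fin 4 → Derivation ℝ R R
  m : Fin 4 → R
  e : Fin 4 → R
  k : Fin 4 → R
  p : R
  m_eq : m = ![-(12 * π q), 0, 1, 0]
  e_eq : e = ![1, 0, 0, 0]
  k_eq : k = ![-p, 1, 0, 0]
  d_comm : ∀ κ μ f, d κ (d μ f) = d μ (d κ f)
  d_π : ∀ κ f, d κ (π f) = m κ * π (P f) + e κ * π (D f) + k κ * π (Y f)
  d_m : ∀ κ μ, d κ (m μ) =
    -(12 * (m κ * π (P q) + e κ * π (D q) + k κ * π (Y q))) * e μ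
  d_e : ∀ κ μ, d κ (e μ) = 0
  d_k : ∀ κ μ, d κ (k μ) = -(m κ + 12 * π q * e κ) * e μ

namespace ContactFrame

variable {S R : Type*} [CommRing S] [Algebra ℝ S] [CommRing R] [Algebra ℝ R]
  (E : ContactFrame S R)

lemma derivation_ofNat {T : Type*} [CommRing T] [Algebra ℝ T] (X : Derivation ℝ T T) (c : ℕ)
    [c.AtLeastTwo] : X (ofNat(c) : T) = 0 :=
  X.map_natCast c

lemma derivation_mul {T : Type*} [CommRing T] [Algebra ℝ T] (X : Derivation ℝ T T)
    (f g : T) : X (f * g) = f * X g + X f * g := by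
  rw [Derivation.leibniz, smul_eq_mul, smul_eq_mul, mul_comm g]

/-- One sixth of the relative invariant `w₁`. -/
def om1 : S :=
  2 * (E.D (E.D (E.P (E.P E.q))) - 4 * E.D (E.P (E.Y E.q)) + 6 * E.Y (E.Y E.q))
    + 24 * (4 * E.P E.q * E.P (E.Y E.q) - E.D (E.P (E.P E.q)) * E.P E.q
      - 3 * E.P (E.P E.q) * E.Y E.q)

/-- One sixth of the relative invariant `w₂`. -/
def om2 : S := 2 * E.P (E.P (E.P (E.P E.q)))

/-- The component along `m ∧ k` of the corner entry of the curvature. -/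
def om3 : S := -(E.D E.om2 + 24 * E.P E.q * E.om2)

/-- The coefficient of `e` in the corner entry of the connection. -/
def a2 : S := 4 * E.P (E.Y E.q) - E.D (E.P (E.P E.q))

/-- The coefficient of `k` in the corner entry of the connection. -/
def a3 : S :=
  3 * E.P (E.P (E.Y E.q)) - 2 * E.D (E.P (E.P (E.P E.q))) + 9 * (E.P (E.P E.q) * E.P (E.P E.q))
    - 24 * (E.P E.q * E.P (E.P (E.P E.q)))

/-- The diagonal entry of the connection. -/
def al (κ : Fin 4) : R := -(4 * E.π (E.P E.q) * E.e κ + E.π (E.P (E.P E.q)) * E.k κ)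

/-- The `𝔰𝔩(3)`-valued Cartan connection of the equation, in the gauge `ρ = 1`,
`φ = γ = γ̄ = r = 0`. -/
def conn (κ : Fin 4) : Matrix (Fin 3) (Fin 3) R :=
  !![E.al κ,
      12 * E.π (E.Y E.q) * E.e κ + 3 * E.π (E.P (E.P E.q)) * E.m κ + 2 * E.π E.a2 * E.k κ,
      E.π (E.P (E.P (E.P E.q))) * E.m κ + E.π E.a2 * E.e κ + E.π E.a3 * E.k κ;
    E.e κ, -(2 * E.al κ),
      3 * E.π (E.P (E.P E.q)) * E.e κ + 2 * E.π (E.P (E.P (E.P E.q))) * E.k κ;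
    E.k κ, E.m κ, E.al κ]

/-- The components of the 2-form `k ∧ e`, which is self-dual. -/
def sdForm (μ ν : Fin 4) : R := E.k μ * E.e ν - E.k ν * E.e μ

/-- The components of the 2-form `m ∧ k`, which is anti-self-dual. -/
def asdForm (μ ν : Fin 4) : R := E.m μ * E.k ν - E.m ν * E.k μ

/-- The self-dual part of the curvature of `conn`. -/
def curvSD (μ ν : Fin 4) : Matrix (Fin 3) (Fin 3) R :=
  E.sdForm μ ν • !![0, E.π E.om1, E.π (E.P E.om1); 0, 0, 0; 0, 0, 0]

/-- The anti-self-dual part of the curvature of `conn`. -/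
def curvASD (μ ν : Fin 4) : Matrix (Fin 3) (Fin 3) R :=
  E.asdForm μ ν • !![0, 0, E.π E.om3; 0, 0, E.π E.om2; 0, 0, 0]

set_option maxHeartbeats 1000000 in
theorem curvature_conn (μ ν : Fin 4) :
    (E.conn ν).map (E.d μ) - (E.conn μ).map (E.d ν)
      + (E.conn μ * E.conn ν - E.conn ν * E.conn μ) = E.curvSD μ ν + E.curvASD μ ν := by
  ext a b
  fin_cases a <;> fin_cases b <;>
  simp [conn, curvSD, curvASD, sdForm, asdForm, om1, om2, om3, a2, a3, al,
    -Derivation.leibniz, derivation_mul, derivation_ofNat, E.d_π, E.d_e, E.d_k, E.d_m, E.P_Y, E.P_D,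
    E.Y_D, map_ofNat E.π] <;>
  ring

/-- The part of the Bianchi identity on which the vanishing of the Bach tensor rests. -/
theorem bianchi : E.P (E.P E.om1)
    + (E.D E.om3 + 12 * E.P E.q * E.om3 + 12 * E.Y E.q * E.om2) = 0 := by
  simp [om1, om2, om3, -Derivation.leibniz, derivation_mul, derivation_ofNat, E.P_Y, E.P_D, E.Y_D]
  ring

/-- The components of the 3-form `m ∧ k ∧ e`. -/
def contactVol (κ μ ν : Fin 4) : R :=
  E.m κ * E.sdForm μ ν + E.m μ * E.sdForm ν κ + E.m ν * E.sdForm κ μ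

set_option maxHeartbeats 1000000 in
/-- The covariant exterior derivative of the dual of the curvature has a single entry, which is the
second `p`-derivative of the invariant `w₁`. -/
theorem yangMills_conn (κ μ ν : Fin 4) :
    ((E.curvSD μ ν - E.curvASD μ ν).map (E.d κ)
        + (E.conn κ * (E.curvSD μ ν - E.curvASD μ ν) - (E.curvSD μ ν - E.curvASD μ ν) * E.conn κ))
      + ((E.curvSD ν κ - E.curvASD ν κ).map (E.d μ)
        + (E.conn μ * (E.curvSD ν κ - E.curvASD ν κ) - (E.curvSD ν κ - E.curvASD ν κ) * E.conn μ))
      + ((E.curvSD κ μ - E.curvASD κ μ).map (E.d ν)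
        + (E.conn ν * (E.curvSD κ μ - E.curvASD κ μ) - (E.curvSD κ μ - E.curvASD κ μ) * E.conn ν))
      = (2 * E.contactVol κ μ ν) • !![0, 0, E.π (E.P (E.P E.om1)); 0, 0, 0; 0, 0, 0] := by
  have hb := congrArg E.π E.bianchi
  have h3 : E.om3 = -(E.D E.om2 + 24 * E.P E.q * E.om2) := rfl
  ext a b
  fin_cases a <;> fin_cases b <;>
  simp [conn, curvSD, curvASD, sdForm, asdForm, contactVol, al,
    -Derivation.leibniz, derivation_mul, E.d_π, E.d_e, E.d_k, E.d_m, map_ofNat E.π] at hb ⊢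
  any_goals ring1
  · linear_combination -(E.m κ * (E.k μ * E.e ν - E.k ν * E.e μ)
      + E.m μ * (E.k ν * E.e κ - E.k κ * E.e ν) + E.m ν * (E.k κ * E.e μ - E.k μ * E.e κ)) * hb
  · rw [h3]
    simp [map_ofNat E.π]
    ring

end ContactFrame

/-! ### Recognition of the normal conformal connection -/

section MatrixDerivation

variable {R : Type*} [CommRing R] [Algebra ℝ R] (X : Derivation ℝ R R)

lemma map_derivation_mul {l m n : Type*} [Fintype m] (M : Matrix l m R) (N : Matrix m n R) :
    (M * N).map X = M.map X * N + M * N.map X := by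
  ext i j
  simp only [map_apply, mul_apply, map_sum, Matrix.add_apply, ← Finset.sum_add_distrib]
  refine Finset.sum_congr rfl fun k _ => ?_
  rw [Derivation.leibniz, smul_eq_mul, smul_eq_mul]
  ring

lemma map_derivation_add {m n : Type*} (M N : Matrix m n R) :
    (M + N).map X = M.map X + N.map X := by
  ext i j; simp

/-- The curvature `∂_κ A_μ - ∂_μ A_κ + [A_κ, A_μ]` of a matrix valued 1-form. -/
def curvature {n : Type*} [Fintype n] (d : Fin 4 → Derivation ℝ R R) (A : Fin 4 → Matrix n n R)
    (κ μ : Fin 4) : Matrix n n R :=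
  (A μ).map (d κ) - (A κ).map (d μ) + (A κ * A μ - A μ * A κ)

end MatrixDerivation

/-- The Gram matrix of a conformal frame: the first and the last vector are null, have the product
`-1` with each other and are orthogonal to the other four, whose Gram matrix is `g`. -/
def confGram {R : Type*} [CommRing R] (g : Matrix (Fin 4) (Fin 4) R) : Matrix ConfIdx ConfIdx R :=
  Matrix.of fun A B => match A, B with
    | .inl _, .inr (.inr _) => -1
    | .inr (.inr _), .inl _ => -1
    | .inr (.inl a), .inr (.inl b) => g a b
    | _, _ => 0

lemma confGram_mul_inv {R : Type*} [CommRing R] {g : Matrix (Fin 4) (Fin 4) R} (h : IsUnit g.det) :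
    confGram g⁻¹ * confGram g = 1 := by
  have h1 := Matrix.nonsing_inv_mul g h
  ext A B
  rcases A with _ | a | _ <;> rcases B with _ | b | _ <;>
    simp [confGram, mul_apply, one_apply]
  simpa [mul_apply, one_apply] using congrFun (congrFun h1 a) b

/-- A frame `N` in a bundle with a metric `J` and a metric connection `A`, whose first vector is
null and whose next four vectors are the covariant derivatives of the first one. -/
structure ConfFrame (R I : Type*) [CommRing R] [Algebra ℝ R] [Fintype I] [DecidableEq I] where
  d : Fin 4 → Derivation ℝ R R
  d_comm : ∀ κ μ f, d κ (d μ f) = d μ (d κ f)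
  card_eq : Fintype.card I = Fintype.card ConfIdx
  J : Matrix I I R
  J_symm : Jᵀ = J
  map_J : ∀ κ, J.map (d κ) = 0
  A : Fin 4 → Matrix I I R
  A_skew : ∀ κ, (A κ)ᵀ * J + J * A κ = 0
  g : Matrix (Fin 4) (Fin 4) R
  isUnit_det : IsUnit g.det
  N : Matrix I ConfIdx R
  gram : Nᵀ * J * N = confGram g
  deriv_zero : ∀ κ x, (N.map (d κ) + A κ * N) x (.inl ()) = N x (.inr (.inl κ))

namespace ConfFrame

variable {R I : Type*} [CommRing R] [Algebra ℝ R] [Fintype I] [DecidableEq I] (T : ConfFrame R I)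

/-- The inverse of the frame matrix. -/
def Ninv : Matrix ConfIdx I R := confGram T.g⁻¹ * T.Nᵀ * T.J

lemma Ninv_mul : T.Ninv * T.N = 1 := by
  rw [Ninv, Matrix.mul_assoc, Matrix.mul_assoc, ← Matrix.mul_assoc T.Nᵀ, T.gram,
    confGram_mul_inv T.isUnit_det]

lemma mul_Ninv : T.N * T.Ninv = 1 := (mul_eq_one_comm_of_card_eq _ _ _ T.card_eq).2 T.Ninv_mul

/-- The covariant derivative of the frame. -/
def DN (κ : Fin 4) : Matrix I ConfIdx R := T.N.map (T.d κ) + T.A κ * T.N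

/-- The connection, in the frame. -/
def K (κ : Fin 4) : Matrix ConfIdx ConfIdx R := T.Ninv * T.DN κ

/-- The connection, in the frame, with its upper index lowered. -/
def L (κ : Fin 4) : Matrix ConfIdx ConfIdx R := T.Nᵀ * T.J * T.DN κ

lemma K_eq (κ : Fin 4) : T.K κ = confGram T.g⁻¹ * T.L κ := by
  simp only [K, L, Ninv, Matrix.mul_assoc]

lemma N_mul_K (κ : Fin 4) : T.N * T.K κ = T.DN κ := by
  rw [K, ← Matrix.mul_assoc, T.mul_Ninv, Matrix.one_mul]

lemma L_add_transpose (κ : Fin 4) : T.L κ + (T.L κ)ᵀ = (confGram T.g).map (T.d κ) := by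
  have h : (T.DN κ)ᵀ = T.Nᵀ.map (T.d κ) + T.Nᵀ * (T.A κ)ᵀ := by
    rw [DN, transpose_add, transpose_mul]; rfl
  have hA : (T.A κ)ᵀ * T.J = -(T.J * T.A κ) := eq_neg_of_add_eq_zero_left (T.A_skew κ)
  rw [← T.gram, map_derivation_mul, map_derivation_mul, T.map_J, L, transpose_mul, transpose_mul,
    transpose_transpose, T.J_symm, h, DN, Matrix.mul_zero, add_zero, Matrix.add_mul, Matrix.mul_add,
    Matrix.mul_assoc T.Nᵀ (T.A κ)ᵀ, ← Matrix.mul_assoc (T.A κ)ᵀ, hA]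
  simp only [Matrix.mul_neg, Matrix.neg_mul, Matrix.mul_assoc]
  abel

lemma L_zero (κ : Fin 4) (A : ConfIdx) : T.L κ A (.inl ()) = confGram T.g A (.inr (.inl κ)) := by
  rw [← T.gram, L, mul_apply, mul_apply]
  exact Finset.sum_congr rfl fun x _ => by rw [DN, T.deriv_zero]

lemma L_zero_left (κ : Fin 4) (A : ConfIdx) :
    T.L κ (.inl ()) A = -confGram T.g A (.inr (.inl κ)) := by
  have h := congrFun (congrFun (T.L_add_transpose κ) (.inl ())) A
  rw [Matrix.add_apply, transpose_apply, L_zero] at h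
  rw [eq_neg_iff_add_eq_zero, h]
  rcases A with _ | a | _ <;> simp [confGram]

lemma L_last_last (κ : Fin 4) : T.L κ (.inr (.inr ())) (.inr (.inr ())) = 0 := by
  have h := congrFun (congrFun (T.L_add_transpose κ) (.inr (.inr ()))) (.inr (.inr ()))
  rw [Matrix.add_apply, transpose_apply] at h
  simp only [confGram, map_apply, of_apply, map_zero] at h
  have h2 : (2 : ℝ) • T.L κ (.inr (.inr ())) (.inr (.inr ())) = 0 := by rw [two_smul, h]
  have h3 := congrArg (fun x => (2⁻¹ : ℝ) • x) h2
  simpa [smul_smul] using h3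

lemma L_last_right (κ b : Fin 4) : T.L κ (.inr (.inl b)) (.inr (.inr ()))
    = -T.L κ (.inr (.inr ())) (.inr (.inl b)) := by
  have h := congrFun (congrFun (T.L_add_transpose κ) (.inr (.inl b))) (.inr (.inr ()))
  rw [Matrix.add_apply, transpose_apply] at h
  simp only [confGram, map_apply, of_apply, map_zero] at h
  exact eq_neg_of_add_eq_zero_left h

lemma L_add (κ a b : Fin 4) : T.L κ (.inr (.inl a)) (.inr (.inl b))
    + T.L κ (.inr (.inl b)) (.inr (.inl a)) = T.d κ (T.g a b) :=
  congrFun (congrFun (T.L_add_transpose κ) (.inr (.inl a))) (.inr (.inl b))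

lemma K_first (κ : Fin 4) (B : ConfIdx) : T.K κ (.inl ()) B = -T.L κ (.inr (.inr ())) B := by
  rw [K_eq, mul_apply]; simp [confGram]

lemma K_last (κ : Fin 4) (B : ConfIdx) : T.K κ (.inr (.inr ())) B = -T.L κ (.inl ()) B := by
  rw [K_eq, mul_apply]; simp [confGram]

lemma K_mid (κ a : Fin 4) (B : ConfIdx) : T.K κ (.inr (.inl a)) B
    = ∑ c, T.g⁻¹ a c * T.L κ (.inr (.inl c)) B := by
  rw [K_eq, mul_apply]; simp [confGram]

/-- The Schouten tensor that is read off from the connection. -/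
def sch (b κ : Fin 4) : R := T.L κ (.inr (.inr ())) (.inr (.inl b))

lemma K_first_zero (κ : Fin 4) : T.K κ (.inl ()) (.inl ()) = 0 := by
  rw [K_first, L_zero]; simp [confGram]

lemma K_first_mid (κ b : Fin 4) : T.K κ (.inl ()) (.inr (.inl b)) = -T.sch b κ := T.K_first _ _

lemma K_first_last (κ : Fin 4) : T.K κ (.inl ()) (.inr (.inr ())) = 0 := by
  rw [K_first, L_last_last, neg_zero]

lemma K_last_zero (κ : Fin 4) : T.K κ (.inr (.inr ())) (.inl ()) = 0 := by
  rw [K_last, L_zero]; simp [confGram]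

lemma K_last_mid (κ b : Fin 4) : T.K κ (.inr (.inr ())) (.inr (.inl b)) = T.g b κ := by
  rw [K_last, L_zero_left]; simp [confGram]

lemma K_last_last (κ : Fin 4) : T.K κ (.inr (.inr ())) (.inr (.inr ())) = 0 := by
  rw [K_last, L_zero_left]; simp [confGram]

lemma K_mid_zero (κ a : Fin 4) : T.K κ (.inr (.inl a)) (.inl ()) = if a = κ then 1 else 0 := by
  have h := congrFun (congrFun (Matrix.nonsing_inv_mul T.g T.isUnit_det) a) κ
  rw [mul_apply, one_apply] at h
  rw [K_mid, ← h]
  exact Finset.sum_congr rfl fun c _ => by rw [L_zero]; rfl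

lemma K_mid_last (κ a : Fin 4) : T.K κ (.inr (.inl a)) (.inr (.inr ()))
    = -∑ c, T.g⁻¹ a c * T.sch c κ := by
  rw [K_mid, ← Finset.sum_neg_distrib]
  exact Finset.sum_congr rfl fun c _ => by rw [L_last_right, mul_neg]; rfl

lemma L_mid (κ a b : Fin 4) : T.L κ (.inr (.inl a)) (.inr (.inl b))
    = ∑ c, T.g a c * T.K κ (.inr (.inl c)) (.inr (.inl b)) := by
  have h : T.L κ = confGram T.g * T.K κ := by
    rw [K, ← T.gram, Matrix.mul_assoc, ← Matrix.mul_assoc T.N, T.mul_Ninv, Matrix.one_mul, L]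
  rw [h, mul_apply]; simp [confGram]

lemma g_symm : T.gᵀ = T.g := by
  have h : (T.Nᵀ * T.J * T.N)ᵀ = T.Nᵀ * T.J * T.N := by
    rw [transpose_mul, transpose_mul, transpose_transpose, T.J_symm, Matrix.mul_assoc]
  rw [T.gram] at h
  ext a b
  exact congrFun (congrFun h (.inr (.inl a))) (.inr (.inl b))

/-- The curvature of the connection in the frame. -/
theorem curvature_K (κ μ : Fin 4) :
    curvature T.d T.K κ μ = T.Ninv * curvature T.d T.A κ μ * T.N := by
  have h : T.N * curvature T.d T.K κ μ = curvature T.d T.A κ μ * T.N := by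
    have hd : ∀ κ, T.N.map (T.d κ) = T.N * T.K κ - T.A κ * T.N := fun κ => by
      rw [T.N_mul_K, DN, add_sub_cancel_right]
    have h2 : ∀ κ μ, T.N * (T.K μ).map (T.d κ) = (T.N.map (T.d μ)).map (T.d κ)
        + (T.A μ).map (T.d κ) * T.N + T.A μ * (T.N.map (T.d κ)) - T.N.map (T.d κ) * T.K μ := by
      intro κ μ
      have h3 := congrArg (fun M : Matrix I ConfIdx R => M.map (T.d κ)) (T.N_mul_K μ)
      simp only [DN, map_derivation_add, map_derivation_mul] at h3
      rw [eq_sub_iff_add_eq, add_comm, h3, add_assoc]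
    have h4 : (T.N.map (T.d μ)).map (T.d κ) = (T.N.map (T.d κ)).map (T.d μ) := by
      ext x y
      exact T.d_comm _ _ _
    simp only [curvature, Matrix.mul_add, Matrix.mul_sub, Matrix.add_mul, Matrix.sub_mul]
    rw [h2, h2, h4, hd, hd]
    simp only [Matrix.mul_sub, Matrix.sub_mul, Matrix.mul_assoc]
    abel
  rw [Matrix.mul_assoc, ← h, ← Matrix.mul_assoc, T.Ninv_mul, Matrix.one_mul]

/-- The curvature annihilates the first vector of the frame. -/
def TorsionFree : Prop := ∀ κ μ x, (curvature T.d T.A κ μ * T.N) x (.inl ()) = 0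

/-- The Ricci contraction of the curvature vanishes. -/
def RicciFree : Prop := ∀ b ν,
  ∑ a, (T.Ninv * curvature T.d T.A a ν * T.N) (.inr (.inl a)) (.inr (.inl b)) = 0

lemma K_symm (h : T.TorsionFree) (κ μ a : Fin 4) : T.K κ (.inr (.inl a)) (.inr (.inl μ))
    = T.K μ (.inr (.inl a)) (.inr (.inl κ)) := by
  have h1 := congrFun (congrFun (T.curvature_K κ μ) (.inr (.inl a))) (.inl ())
  rw [Matrix.mul_assoc, Matrix.mul_apply (M := T.Ninv),
    Finset.sum_eq_zero fun x _ => by rw [h κ μ, mul_zero]] at h1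
  simp only [curvature, Matrix.add_apply,
    Matrix.sub_apply, map_apply, mul_apply, Fintype.sum_sum_type, Fintype.sum_unique,
    PUnit.default_eq_unit,
    K_first_zero, K_last_zero, K_mid_zero] at h1
  have hc : ∀ (κ : Fin 4) (p : Prop) [Decidable p], T.d κ (if p then 1 else 0) = 0 := by
    intro κ p _; split_ifs <;> simp
  simp [hc] at h1
  exact sub_eq_zero.1 h1

lemma curvature_mid (κ μ a b : Fin 4) :
    T.d κ (T.K μ (.inr (.inl a)) (.inr (.inl b))) - T.d μ (T.K κ (.inr (.inl a)) (.inr (.inl b)))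
      + ∑ e, (T.K κ (.inr (.inl a)) (.inr (.inl e)) * T.K μ (.inr (.inl e)) (.inr (.inl b))
        - T.K μ (.inr (.inl a)) (.inr (.inl e)) * T.K κ (.inr (.inl e)) (.inr (.inl b)))
    = (T.Ninv * curvature T.d T.A κ μ * T.N) (.inr (.inl a)) (.inr (.inl b))
      + (if a = κ then 1 else 0) * T.sch b μ - (if a = μ then 1 else 0) * T.sch b κ
      + (∑ c, T.g⁻¹ a c * T.sch c κ) * T.g b μ - (∑ c, T.g⁻¹ a c * T.sch c μ) * T.g b κ := by
  rw [← curvature_K]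
  simp only [curvature, Matrix.add_apply,
    Matrix.sub_apply, map_apply, mul_apply, Fintype.sum_sum_type, Fintype.sum_unique,
    PUnit.default_eq_unit,
    K_first_mid, K_last_mid, K_mid_zero, K_mid_last, Finset.sum_sub_distrib]
  ring

/-- The covariant derivative of a matrix, in the frame. -/
theorem covariant_deriv_conj (κ : Fin 4) (G : Matrix I I R) :
    (T.Ninv * G * T.N).map (T.d κ)
        + (T.K κ * (T.Ninv * G * T.N) - (T.Ninv * G * T.N) * T.K κ)
      = T.Ninv * (G.map (T.d κ) + (T.A κ * G - G * T.A κ)) * T.N := by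
  set H := T.Ninv * G * T.N with hH
  have hd : T.N.map (T.d κ) = T.N * T.K κ - T.A κ * T.N := by
    rw [T.N_mul_K, DN, add_sub_cancel_right]
  have hNH : T.N * H = G * T.N := by
    rw [hH, ← Matrix.mul_assoc, ← Matrix.mul_assoc, T.mul_Ninv, Matrix.one_mul]
  have h1 := congrArg (fun M : Matrix I ConfIdx R => M.map (T.d κ)) hNH
  simp only [map_derivation_mul] at h1
  have h : T.N * (H.map (T.d κ) + (T.K κ * H - H * T.K κ))
      = (G.map (T.d κ) + (T.A κ * G - G * T.A κ)) * T.N := by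
    have h2 : T.N * H.map (T.d κ)
        = G.map (T.d κ) * T.N + G * T.N.map (T.d κ) - T.N.map (T.d κ) * H := by
      rw [← h1, add_sub_cancel_left]
    have h3 : T.A κ * T.N * H = T.A κ * (G * T.N) := by rw [Matrix.mul_assoc, hNH]
    have h4 : T.N * (H * T.K κ) = G * (T.N * T.K κ) := by
      rw [← Matrix.mul_assoc, hNH, Matrix.mul_assoc]
    rw [Matrix.mul_add, Matrix.mul_sub, h2, hd, Matrix.sub_mul, h3, h4]
    simp only [Matrix.mul_sub, Matrix.add_mul, Matrix.sub_mul, Matrix.mul_assoc]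
    abel
  rw [Matrix.mul_assoc T.Ninv (_ + _), ← h, ← Matrix.mul_assoc T.Ninv T.N, T.Ninv_mul,
    Matrix.one_mul]

end ConfFrame

/-! ### Curvature in coordinates from a conformal frame -/

/-- The Koszul formula: a torsion-free connection that preserves the metric is determined by the
derivatives `T c a b = ∂_c g_ab` of the metric. -/
lemma koszul {g : Matrix (Fin 4) (Fin 4) ℝ} (hdet : IsUnit g.det)
    {T γ : Fin 4 → Fin 4 → Fin 4 → ℝ} (hγ : ∀ a b c, γ a b c = γ a c b)
    (hT : ∀ c a b, T c a b = ∑ e, g a e * γ e c b + ∑ e, g b e * γ e c a) (a b c : Fin 4) :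
    (1 / 2) * ∑ e, g⁻¹ a e * (T b e c + T c e b - T e b c) = γ a b c := by
  have h1 : ∀ e, T b e c + T c e b - T e b c = 2 * ∑ f, g e f * γ f b c := by
    intro e
    have h2 : ∑ f, g e f * γ f c b = ∑ f, g e f * γ f b c :=
      Finset.sum_congr rfl fun f _ => by rw [hγ f c b]
    have h3 : ∑ f, g c f * γ f e b = ∑ f, g c f * γ f b e :=
      Finset.sum_congr rfl fun f _ => by rw [hγ f e b]
    have h4 : ∑ f, g b f * γ f e c = ∑ f, g b f * γ f c e :=
      Finset.sum_congr rfl fun f _ => by rw [hγ f e c]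
    rw [hT b e c, hT c e b, hT e b c, h2, h3, h4]
    ring
  have h5 := congrFun (Matrix.mulVec_mulVec (fun f => γ f b c) g⁻¹ g) a
  rw [Matrix.nonsing_inv_mul g hdet, Matrix.one_mulVec] at h5
  rw [← h5]
  simp only [Matrix.mulVec, dotProduct, h1, Finset.mul_sum]
  refine Finset.sum_congr rfl fun e _ => Finset.sum_congr rfl fun f _ => by ring

/-- The decomposition of a curvature tensor into a trace-free part and a Schouten part: the second
part is the Schouten tensor. -/
lemma schouten_of_decomposition {g : Matrix (Fin 4) (Fin 4) ℝ} (hdet : IsUnit g.det)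
    (hg : gᵀ = g) {C Rm : Fin 4 → Fin 4 → Fin 4 → Fin 4 → ℝ} {P : Fin 4 → Fin 4 → ℝ}
    (hC : ∀ b d, ∑ a, C a b a d = 0)
    (hR : ∀ a b c d, Rm a b c d = C a b c d + (if a = c then 1 else 0) * P b d
      - (if a = d then 1 else 0) * P b c + (∑ e, g⁻¹ a e * P e c) * g b d
      - (∑ e, g⁻¹ a e * P e d) * g b c) (b d : Fin 4) :
    (1 / 2) * ((∑ a, Rm a b a d)
      - (∑ b, ∑ d, g⁻¹ b d * ∑ a, Rm a b a d) / 6 * g b d) = P b d := by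
  have hginv : g⁻¹ᵀ = g⁻¹ := by rw [Matrix.transpose_nonsing_inv, hg]
  have hsymm : ∀ a b, g a b = g b a := fun a b => congrFun (congrFun hg b) a
  have hgg : ∀ a c, ∑ e, g a e * g⁻¹ e c = if a = c then 1 else 0 := fun a c => by
    rw [← Matrix.mul_apply, Matrix.mul_nonsing_inv g hdet, Matrix.one_apply]
  have htr : ∑ b, ∑ d, g⁻¹ b d * g b d = 4 := by
    have : ∀ b, ∑ d, g⁻¹ b d * g b d = 1 := fun b => by
      have h := hgg b b
      rw [if_pos rfl] at h
      rw [← h]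
      refine Finset.sum_congr rfl fun d _ => ?_
      rw [mul_comm, show g⁻¹ b d = g⁻¹ d b from congrFun (congrFun hginv d) b]
    simp [this]
  set t := ∑ a, ∑ e, g⁻¹ a e * P e a with ht
  have ht' : ∑ b, ∑ d, g⁻¹ b d * P b d = t := by
    rw [ht, Finset.sum_comm]
    refine Finset.sum_congr rfl fun b _ => Finset.sum_congr rfl fun d _ => ?_
    rw [show g⁻¹ d b = g⁻¹ b d from congrFun (congrFun hginv b) d]
  have hRic : ∀ b d, ∑ a, Rm a b a d = 2 * P b d + t * g b d := by
    intro b d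
    have h1 : ∑ a, (∑ e, g⁻¹ a e * P e d) * g b a = P b d := by
      have h2 := congrFun (Matrix.mulVec_mulVec (fun f => P f d) g g⁻¹) b
      rw [Matrix.mul_nonsing_inv g hdet, Matrix.one_mulVec] at h2
      rw [← h2]
      simp only [Matrix.mulVec, dotProduct]
      exact Finset.sum_congr rfl fun a _ => mul_comm _ _
    simp only [hR, Finset.sum_add_distrib, Finset.sum_sub_distrib, hC, h1, ← Finset.sum_mul]
    simp [← ht]
    ring
  have hsc : ∑ b, ∑ d, g⁻¹ b d * ∑ a, Rm a b a d = 6 * t := by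
    have h1 : ∀ b d, g⁻¹ b d * ∑ a, Rm a b a d
        = 2 * (g⁻¹ b d * P b d) + t * (g⁻¹ b d * g b d) := fun b d => by rw [hRic]; ring
    simp only [h1, Finset.sum_add_distrib, ← Finset.mul_sum, ht', htr]
    ring
  rw [hRic, hsc]
  ring

/-- The value of a matrix of smooth functions at a point. -/
def evalM {n : ℕ} {V : Opens (Fin n → ℝ)} {l m : Type*} (q : V) (M : Matrix l m (smoothAlg V)) :
    Matrix l m ℝ :=
  M.map (smoothAlg.eval q)

section evalM

variable {n : ℕ} {V : Opens (Fin n → ℝ)} {l m k : Type*} (q : V)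

lemma evalM_apply (M : Matrix l m (smoothAlg V)) (a : l) (b : m) : evalM q M a b = (M a b).1 q :=
  rfl

lemma evalM_mul [Fintype m] (M : Matrix l m (smoothAlg V)) (N : Matrix m k (smoothAlg V)) :
    evalM q (M * N) = evalM q M * evalM q N := by
  rw [evalM, Matrix.map_mul]; rfl

lemma evalM_add (M N : Matrix l m (smoothAlg V)) : evalM q (M + N) = evalM q M + evalM q N := by
  ext a b; rfl

lemma evalM_sub (M N : Matrix l m (smoothAlg V)) : evalM q (M - N) = evalM q M - evalM q N := by
  ext a b; rfl

lemma evalM_zero : evalM q (0 : Matrix l m (smoothAlg V)) = 0 := by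
  ext a b; rfl

lemma evalM_inv [Fintype m] [DecidableEq m] {M : Matrix m m (smoothAlg V)} (h : IsUnit M.det) :
    (evalM q M)⁻¹ = evalM q M⁻¹ := by
  refine Matrix.inv_eq_left_inv ?_
  rw [← evalM_mul, Matrix.nonsing_inv_mul _ h, evalM, Matrix.map_one _ (map_zero _) (map_one _)]

lemma isUnit_det_evalM [Fintype m] [DecidableEq m] {M : Matrix m m (smoothAlg V)}
    (h : IsUnit M.det) : IsUnit (evalM q M).det := by
  have := h.map (smoothAlg.eval q)
  rwa [AlgHom.map_det] at this

end evalM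

namespace ConfFrame

variable {V : Opens (Fin 4 → ℝ)} {I : Type*} [Fintype I] [DecidableEq I]
  {T : ConfFrame (smoothAlg V) I} {gf : (Fin 4 → ℝ) → Matrix (Fin 4) (Fin 4) ℝ}

lemma christoffel_eq (hd : T.d = smoothAlg.pder) (hg : ∀ q : V, gf q = evalM q T.g)
    (ht : T.TorsionFree) (q : V) (a b c : Fin 4) :
    christoffel gf a b c q = (T.K b (.inr (.inl a)) (.inr (.inl c))).1 q := by
  have hpd : ∀ c a b, pd c (fun y => gf y a b) q = (T.d c (T.g a b)).1 q := by
    intro c a b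
    rw [hd, smoothAlg.pder_apply c (T.g a b) (F := fun y => gf y a b)]
    intro x
    simp only [hg x, evalM_apply]
  unfold christoffel
  simp only [hpd]
  rw [hg]
  refine koszul (g := evalM q T.g) (isUnit_det_evalM q T.isUnit_det)
    (T := fun c a b => (T.d c (T.g a b)).1 q)
    (γ := fun a b c => (T.K b (.inr (.inl a)) (.inr (.inl c))).1 q) ?_ ?_ a b c
  · intro a b c
    rw [T.K_symm ht]
  · intro c a b
    rw [← T.L_add, L_mid, L_mid]
    simp only [evalM_apply, ← smoothAlg.eval_apply, map_add, map_sum, map_mul]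

lemma riemann_eq (hd : T.d = smoothAlg.pder) (hg : ∀ q : V, gf q = evalM q T.g)
    (ht : T.TorsionFree) (q : V) (a b c d : Fin 4) :
    riemann gf a b c d q =
      ((T.Ninv * curvature T.d T.A c d * T.N) (.inr (.inl a)) (.inr (.inl b))).1 q
        + (if a = c then 1 else 0) * (T.sch b d).1 q - (if a = d then 1 else 0) * (T.sch b c).1 q
        + (∑ e, (gf q)⁻¹ a e * (T.sch e c).1 q) * gf q b d
        - (∑ e, (gf q)⁻¹ a e * (T.sch e d).1 q) * gf q b c := by
  have hpd : ∀ c d, pd c (christoffel gf a d b) q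
      = (T.d c (T.K d (.inr (.inl a)) (.inr (.inl b)))).1 q := by
    intro c d
    rw [hd, smoothAlg.pder_apply c _ (fun x => (christoffel_eq hd hg ht x a d b).symm)]
  have h := congrArg (smoothAlg.eval q) (T.curvature_mid c d a b)
  unfold riemann
  rw [hpd, hpd, hg, evalM_inv q T.isUnit_det]
  simp only [christoffel_eq hd hg ht, evalM_apply, ← smoothAlg.eval_apply]
  simp only [map_add, map_sub, map_sum, map_mul] at h
  rw [h]
  simp only [apply_ite (smoothAlg.eval q), map_one, map_zero]

lemma schouten_eq (hd : T.d = smoothAlg.pder) (hg : ∀ q : V, gf q = evalM q T.g)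
    (ht : T.TorsionFree) (hr : T.RicciFree) (q : V) (b d : Fin 4) :
    schouten gf b d q = (T.sch b d).1 q := by
  unfold schouten scalarCurv ricci
  refine schouten_of_decomposition (g := gf q) ?_ ?_
    (C := fun a b c d =>
      ((T.Ninv * curvature T.d T.A c d * T.N) (.inr (.inl a)) (.inr (.inl b))).1 q)
    (Rm := fun a b c d => riemann gf a b c d q) (P := fun b d => (T.sch b d).1 q) ?_
    (fun a b c d => riemann_eq hd hg ht q a b c d) b d
  · rw [hg]; exact isUnit_det_evalM q T.isUnit_det
  · rw [hg]
    have := congrArg (evalM q) T.g_symm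
    exact this
  · intro b d
    have h := congrArg (smoothAlg.eval q) (hr b d)
    rwa [map_sum, map_zero] at h

/-- A conformal frame with torsion-free and Ricci-free curvature computes Cartan's normal conformal
connection. -/
theorem confConn_eq (hd : T.d = smoothAlg.pder) (hg : ∀ q : V, gf q = evalM q T.g)
    (ht : T.TorsionFree) (hr : T.RicciFree) (q : V) (μ : Fin 4) :
    confConn gf μ q = evalM q (T.K μ) := by
  ext A B
  rw [evalM_apply]
  rcases A with _ | a | _ <;> rcases B with _ | b | _ <;> simp only [confConn, of_apply]
  · rw [K_first_zero]; rfl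
  · rw [K_first_mid, schouten_eq hd hg ht hr]; rfl
  · rw [K_first_last]; rfl
  · rw [K_mid_zero]; split_ifs <;> rfl
  · rw [christoffel_eq hd hg ht]
  · rw [K_mid_last, hg, evalM_inv q T.isUnit_det]
    simp only [schouten_eq hd hg ht hr, evalM_apply, ← smoothAlg.eval_apply, map_neg, map_sum,
      map_mul]
  · rw [K_last_zero]; rfl
  · rw [K_last_mid, hg]; rfl
  · rw [K_last_last]; rfl

lemma pdMat_eq {f : (Fin 4 → ℝ) → Matrix ConfIdx ConfIdx ℝ}
    {M : Matrix ConfIdx ConfIdx (smoothAlg V)} (h : ∀ q : V, f q = evalM q M) (μ : Fin 4) (q : V) :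
    pdMat μ f q = evalM q (M.map (smoothAlg.pder μ)) := by
  ext A B
  rw [evalM_apply, map_apply, smoothAlg.pder_apply μ (M A B) (F := fun y => f y A B)]
  · rfl
  · intro x
    simp only [h x, evalM_apply]

theorem confCurv_eq (hd : T.d = smoothAlg.pder) (hg : ∀ q : V, gf q = evalM q T.g)
    (ht : T.TorsionFree) (hr : T.RicciFree) (q : V) (μ ν : Fin 4) :
    confCurv gf μ ν q = evalM q (T.Ninv * curvature T.d T.A μ ν * T.N) := by
  rw [← curvature_K, curvature, confCurv, pdMat_eq (confConn_eq hd hg ht hr · ν),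
    pdMat_eq (confConn_eq hd hg ht hr · μ), confConn_eq hd hg ht hr, confConn_eq hd hg ht hr,
    evalM_add, evalM_sub, evalM_sub, evalM_mul, evalM_mul, hd]

lemma lower_mid (M : Matrix I I (smoothAlg V)) (a b : Fin 4) :
    ∑ e, T.g a e * (T.Ninv * M * T.N) (.inr (.inl e)) (.inr (.inl b))
      = (T.Nᵀ * T.J * M * T.N) (.inr (.inl a)) (.inr (.inl b)) := by
  have h : confGram T.g * (T.Ninv * M * T.N) = T.Nᵀ * T.J * M * T.N := by
    rw [← T.gram]
    simp only [← Matrix.mul_assoc]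
    rw [Matrix.mul_assoc (T.Nᵀ * T.J) T.N, T.mul_Ninv, Matrix.mul_one]
  rw [← h, mul_apply (M := confGram T.g)]
  simp [confGram]

/-- The Weyl tensor is the curvature of the conformal frame, with its indices lowered. -/
theorem weyl_eq (hd : T.d = smoothAlg.pder) (hg : ∀ q : V, gf q = evalM q T.g)
    (ht : T.TorsionFree) (hr : T.RicciFree) (q : V) (a b c d : Fin 4) :
    weyl gf q a b c d =
      ((T.Nᵀ * T.J * curvature T.d T.A c d * T.N) (.inr (.inl a)) (.inr (.inl b))).1 q := by
  have hdet : IsUnit (gf q).det := by rw [hg]; exact isUnit_det_evalM q T.isUnit_det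
  have hP : ∀ c, ∑ e, gf q a e * ∑ f, (gf q)⁻¹ e f * (T.sch f c).1 q = (T.sch a c).1 q := by
    intro c
    have h2 := congrFun (Matrix.mulVec_mulVec (fun f => (T.sch f c).1 q) (gf q) (gf q)⁻¹) a
    rw [Matrix.mul_nonsing_inv _ hdet, Matrix.one_mulVec] at h2
    exact h2
  have hC : ∑ e, gf q a e
      * ((T.Ninv * curvature T.d T.A c d * T.N) (.inr (.inl e)) (.inr (.inl b))).1 q
      = ((T.Nᵀ * T.J * curvature T.d T.A c d * T.N) (.inr (.inl a)) (.inr (.inl b))).1 q := by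
    rw [← lower_mid, hg]
    simp only [evalM_apply, ← smoothAlg.eval_apply, map_sum, map_mul]
  unfold weyl
  simp only [riemann_eq hd hg ht, schouten_eq hd hg ht hr, mul_add, mul_sub,
    Finset.sum_add_distrib, Finset.sum_sub_distrib, hC, ← mul_assoc, ← Finset.sum_mul, hP]
  simp
  ring

end ConfFrame

/-! ### Algebra of a null tetrad -/

/-- The Gram matrix of a null tetrad: the metric is `2 θ¹ θ² + 2 θ³ θ⁴`. -/
def nullGram : Matrix (Fin 4) (Fin 4) ℝ := !![0, 1, 0, 0; 1, 0, 0, 0; 0, 0, 0, 1; 0, 0, 1, 0]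

lemma nullGram_mul_self : nullGram * nullGram = 1 := by
  ext a b
  fin_cases a <;> fin_cases b <;> simp [nullGram, mul_apply, Fin.sum_univ_four]

lemma det_nullGram : nullGram.det = 1 := by
  simp [nullGram, det_succ_row_zero, Fin.sum_univ_succ, Fin.succAbove]

lemma det_four_rows (x y u v : Fin 4 → ℝ) : (Matrix.of ![x, y, u, v]).det =
    (x 0 * y 1 - x 1 * y 0) * (u 2 * v 3 - u 3 * v 2)
      - (x 0 * y 2 - x 2 * y 0) * (u 1 * v 3 - u 3 * v 1)
      + (x 0 * y 3 - x 3 * y 0) * (u 1 * v 2 - u 2 * v 1)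
      + (x 1 * y 2 - x 2 * y 1) * (u 0 * v 3 - u 3 * v 0)
      - (x 1 * y 3 - x 3 * y 1) * (u 0 * v 2 - u 2 * v 0)
      + (x 2 * y 3 - x 3 * y 2) * (u 0 * v 1 - u 1 * v 0) := by
  simp [det_succ_row_zero, Fin.sum_univ_succ, Fin.succAbove]
  ring

lemma altSymbol_eq (a b c d : Fin 4) : altSymbol a b c d
    = (Matrix.of ![Pi.single a 1, Pi.single b 1, Pi.single c 1, Pi.single d 1]).det := by
  unfold altSymbol
  congr 1
  ext j k
  fin_cases j <;> simp [Pi.single_apply, eq_comm]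

lemma sum_altSymbol (a b : Fin 4) (u v : Fin 4 → ℝ) :
    ∑ c, ∑ d, altSymbol a b c d * (u c * v d)
      = (Matrix.of ![Pi.single a 1, Pi.single b 1, u, v]).det := by
  simp only [altSymbol_eq, det_four_rows]
  generalize (Pi.single a 1 : Fin 4 → ℝ) = x
  generalize (Pi.single b 1 : Fin 4 → ℝ) = y
  simp [Fin.sum_univ_four, Pi.single_apply]
  ring

lemma altSymbol_swap (a b c d : Fin 4) : altSymbol a b d c = -altSymbol a b c d := by
  simp only [altSymbol_eq, det_four_rows]
  ring

/-- The Hodge dual of a decomposable 2-form `u ∧ v` in terms of the vectors `u'`, `v'` that are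
dual to `u`, `v` with respect to the metric. -/
lemma hodge_wedge (o : (Fin 4 → ℝ) → ℝ) (g : (Fin 4 → ℝ) → Matrix (Fin 4) (Fin 4) ℝ)
    (x u v : Fin 4 → ℝ) (a b : Fin 4) :
    hodge o g x (wedge u v) a b = o x * Real.sqrt |(g x).det| *
      (Matrix.of ![Pi.single a 1, Pi.single b 1, (g x)⁻¹ *ᵥ u, (g x)⁻¹ *ᵥ v]).det := by
  have h1 : ∀ c d, ∑ e, ∑ f, (g x)⁻¹ c e * (g x)⁻¹ d f * wedge u v e f
      = ((g x)⁻¹ *ᵥ u) c * ((g x)⁻¹ *ᵥ v) d - ((g x)⁻¹ *ᵥ u) d * ((g x)⁻¹ *ᵥ v) c := by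
    intro c d
    simp only [mulVec, dotProduct, wedge, Finset.sum_mul_sum, mul_sub, Finset.sum_sub_distrib]
    congr 1
    · refine Finset.sum_congr rfl fun e _ => Finset.sum_congr rfl fun f _ => by ring
    · rw [Finset.sum_comm]
      refine Finset.sum_congr rfl fun e _ => Finset.sum_congr rfl fun f _ => by ring
  set u' := (g x)⁻¹ *ᵥ u
  set v' := (g x)⁻¹ *ᵥ v
  have h2 : ∑ c, ∑ d, altSymbol a b c d * (u' d * v' c)
      = -∑ c, ∑ d, altSymbol a b c d * (u' c * v' d) := by
    rw [Finset.sum_comm, ← Finset.sum_neg_distrib]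
    refine Finset.sum_congr rfl fun e _ => ?_
    rw [← Finset.sum_neg_distrib]
    refine Finset.sum_congr rfl fun f _ => ?_
    rw [altSymbol_swap]; ring
  have h3 : ∀ c d, o x * Real.sqrt |(g x).det| * altSymbol a b c d * (u' c * v' d - u' d * v' c)
      = o x * Real.sqrt |(g x).det| * (altSymbol a b c d * (u' c * v' d)
        - altSymbol a b c d * (u' d * v' c)) := fun c d => by ring
  unfold hodge
  simp only [h1, h3, ← Finset.mul_sum, Finset.sum_sub_distrib, h2, ← sum_altSymbol]
  ring

lemma inv_eq_of_nullTetrad {M h : Matrix (Fin 4) (Fin 4) ℝ} (hM : IsUnit M.det)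
    (hh : h = Mᵀ * nullGram * M) : h⁻¹ = M⁻¹ * nullGram * M⁻¹ᵀ := by
  refine Matrix.inv_eq_left_inv ?_
  have h1 : M⁻¹ᵀ * Mᵀ = 1 := by
    rw [← transpose_mul, Matrix.mul_nonsing_inv _ hM, transpose_one]
  rw [hh]
  calc M⁻¹ * nullGram * M⁻¹ᵀ * (Mᵀ * nullGram * M)
      = M⁻¹ * nullGram * (M⁻¹ᵀ * Mᵀ) * nullGram * M := by simp only [Matrix.mul_assoc]
    _ = M⁻¹ * (nullGram * nullGram) * M := by rw [h1, Matrix.mul_one]; simp only [Matrix.mul_assoc]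
    _ = 1 := by rw [nullGram_mul_self, Matrix.mul_one, Matrix.nonsing_inv_mul _ hM]

lemma mul_inv_mulVec {M h : Matrix (Fin 4) (Fin 4) ℝ} (hM : IsUnit M.det)
    (hh : h = Mᵀ * nullGram * M) (k : Fin 4) : M *ᵥ (h⁻¹ *ᵥ M k) = nullGram.col k := by
  have h1 : M k = Mᵀ *ᵥ Pi.single k 1 := by
    ext a; simp
  have h2 : M⁻¹ᵀ * Mᵀ = 1 := by
    rw [← transpose_mul, Matrix.mul_nonsing_inv _ hM, transpose_one]
  rw [inv_eq_of_nullTetrad hM hh, h1, mulVec_mulVec, mulVec_mulVec, ← Matrix.mul_assoc,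
    ← Matrix.mul_assoc, Matrix.mul_nonsing_inv _ hM, Matrix.one_mul, Matrix.mul_assoc,  h2,
    Matrix.mul_one]
  simp

lemma det_mul_det (M : Matrix (Fin 4) (Fin 4) ℝ) (x y u v : Fin 4 → ℝ) :
    M.det * (Matrix.of ![x, y, u, v]).det
    = (Matrix.of ![M *ᵥ x, M *ᵥ y, M *ᵥ u, M *ᵥ v]).det := by
  rw [mul_comm, ← det_transpose M, ← det_mul]
  congr 1
  ext j k
  fin_cases j <;> simp [mul_apply, mulVec, dotProduct, mul_comm]

lemma det_metric {M h : Matrix (Fin 4) (Fin 4) ℝ} (hh : h = Mᵀ * nullGram * M) :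
    h.det = M.det ^ 2 := by
  rw [hh, det_mul, det_mul, det_transpose, det_nullGram]; ring

lemma sign_mul_sqrt {M h : Matrix (Fin 4) (Fin 4) ℝ} (hh : h = Mᵀ * nullGram * M) :
    Real.sign M.det * Real.sqrt |h.det| = M.det := by
  rw [det_metric hh, abs_of_nonneg (sq_nonneg _), Real.sqrt_sq_eq_abs]
  rcases lt_trichotomy M.det 0 with h | h | h
  · rw [Real.sign_of_neg h, abs_of_neg h]; ring
  · simp [h]
  · rw [Real.sign_of_pos h, abs_of_pos h, one_mul]

lemma hodge_wedge_tetrad {o : (Fin 4 → ℝ) → ℝ} {g θ : (Fin 4 → ℝ) → Matrix (Fin 4) (Fin 4) ℝ}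
    {x : Fin 4 → ℝ} (hθ : IsUnit (θ x).det) (hg : g x = (θ x)ᵀ * nullGram * θ x)
    (ho : o x = Real.sign (θ x).det) (j k a b : Fin 4) :
    hodge o g x (wedge (θ x j) (θ x k)) a b
      = (Matrix.of ![(θ x).col a, (θ x).col b, nullGram.col j, nullGram.col k]).det := by
  rw [hodge_wedge, ho, sign_mul_sqrt hg, det_mul_det, mul_inv_mulVec hθ hg, mul_inv_mulVec hθ hg]
  simp

lemma hodge_selfDual {o : (Fin 4 → ℝ) → ℝ} {g θ : (Fin 4 → ℝ) → Matrix (Fin 4) (Fin 4) ℝ}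
    {x : Fin 4 → ℝ} (hθ : IsUnit (θ x).det) (hg : g x = (θ x)ᵀ * nullGram * θ x)
    (ho : o x = Real.sign (θ x).det) (a b : Fin 4) :
    hodge o g x (wedge (θ x 2) (θ x 1)) a b = wedge (θ x 2) (θ x 1) a b := by
  rw [hodge_wedge_tetrad hθ hg ho, det_four_rows]
  simp [nullGram, wedge]
  ring

lemma hodge_antiSelfDual {o : (Fin 4 → ℝ) → ℝ}
    {g θ : (Fin 4 → ℝ) → Matrix (Fin 4) (Fin 4) ℝ}
    {x : Fin 4 → ℝ} (hθ : IsUnit (θ x).det) (hg : g x = (θ x)ᵀ * nullGram * θ x)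
    (ho : o x = Real.sign (θ x).det) (a b : Fin 4) :
    hodge o g x (wedge (θ x 2) (θ x 0)) a b = -wedge (θ x 2) (θ x 0) a b := by
  rw [hodge_wedge_tetrad hθ hg ho, det_four_rows]
  simp [nullGram, wedge]
  ring

lemma hodge_add (o : (Fin 4 → ℝ) → ℝ) (g : (Fin 4 → ℝ) → Matrix (Fin 4) (Fin 4) ℝ)
    (x : Fin 4 → ℝ) (F G : Fin 4 → Fin 4 → ℝ) (a b : Fin 4) :
    hodge o g x (fun c d => F c d + G c d) a b = hodge o g x F a b + hodge o g x G a b := by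
  simp only [hodge, mul_add, Finset.sum_add_distrib]

lemma hodge_smul (o : (Fin 4 → ℝ) → ℝ) (g : (Fin 4 → ℝ) → Matrix (Fin 4) (Fin 4) ℝ)
    (x : Fin 4 → ℝ) (r : ℝ) (F : Fin 4 → Fin 4 → ℝ) (a b : Fin 4) :
    hodge o g x (fun c d => r * F c d) a b = r * hodge o g x F a b := by
  simp only [hodge, Finset.mul_sum]
  refine Finset.sum_congr rfl fun c _ => Finset.sum_congr rfl fun d _ =>
    Finset.sum_congr rfl fun e _ => Finset.sum_congr rfl fun f _ => by ring

/-- The square of a simple null 2-form is of type N. -/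
lemma isTypeN_of_null {h : Matrix (Fin 4) (Fin 4) ℝ} {u v : Fin 4 → ℝ} {r : ℝ} (hr : r ≠ 0)
    (huv : ∃ a b, wedge u v a b ≠ 0) (huu : u ⬝ᵥ (h⁻¹ *ᵥ u) = 0) (huv' : u ⬝ᵥ (h⁻¹ *ᵥ v) = 0)
    (hvu : v ⬝ᵥ (h⁻¹ *ᵥ u) = 0) :
    IsTypeN h fun a b c d => r * (wedge u v a b * wedge u v c d) := by
  constructor
  · obtain ⟨a, b, hab⟩ := huv
    intro h0
    have := congrFun (congrFun (congrFun (congrFun h0 a) b) a) b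
    simp [hr, hab] at this
  · intro a b c d
    have key : ∀ (a b c d : Fin 4 → ℝ),
        ∑ e, ∑ f, ∑ k, ∑ l, a e * b f * h⁻¹ e k * h⁻¹ f l * (c k * d l)
          = (a ⬝ᵥ (h⁻¹ *ᵥ c)) * (b ⬝ᵥ (h⁻¹ *ᵥ d)) := by
      intro a b c d
      simp only [dotProduct, mulVec]
      rw [Finset.sum_mul_sum]
      refine Finset.sum_congr rfl fun e _ => Finset.sum_congr rfl fun f _ => ?_
      rw [mul_mul_mul_comm, Finset.sum_mul_sum, Finset.mul_sum]
      refine Finset.sum_congr rfl fun k _ => ?_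
      rw [Finset.mul_sum]
      exact Finset.sum_congr rfl fun l _ => by ring
    have hsum : ∑ e, ∑ f, ∑ k, ∑ l, wedge u v e f * h⁻¹ e k * h⁻¹ f l * wedge u v k l = 0 := by
      have h1 : ∀ e f k l, wedge u v e f * h⁻¹ e k * h⁻¹ f l * wedge u v k l
          = u e * v f * h⁻¹ e k * h⁻¹ f l * (u k * v l)
            - u e * v f * h⁻¹ e k * h⁻¹ f l * (v k * u l)
            - v e * u f * h⁻¹ e k * h⁻¹ f l * (u k * v l)
            + v e * u f * h⁻¹ e k * h⁻¹ f l * (v k * u l) := fun e f k l => by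
        unfold wedge; ring
      simp only [h1, Finset.sum_add_distrib, Finset.sum_sub_distrib, key, huu, huv', hvu]
      ring
    have h2 : ∀ e f k l, r * (wedge u v a b * wedge u v e f) * h⁻¹ e k * h⁻¹ f l
          * (r * (wedge u v k l * wedge u v c d))
        = r * r * (wedge u v a b * wedge u v c d)
          * (wedge u v e f * h⁻¹ e k * h⁻¹ f l * wedge u v k l) := fun e f k l => by ring
    simp only [h2, ← Finset.mul_sum, hsum, mul_zero]

lemma dotProduct_inv_mulVec {M h : Matrix (Fin 4) (Fin 4) ℝ} (hM : IsUnit M.det)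
    (hh : h = Mᵀ * nullGram * M) (j k : Fin 4) : M j ⬝ᵥ (h⁻¹ *ᵥ M k) = nullGram j k :=
  congrFun (mul_inv_mulVec hM hh k) j

lemma exists_wedge_ne_zero {M : Matrix (Fin 4) (Fin 4) ℝ} (hM : IsUnit M.det) {j k : Fin 4}
    (hjk : j ≠ k) : ∃ a b, wedge (M j) (M k) a b ≠ 0 := by
  by_contra! h0
  have h1 : ∀ l, (M * M⁻¹) l = fun b => ∑ a, M l a * M⁻¹ a b := fun l => by
    ext b; rw [mul_apply]
  have hMM := Matrix.mul_nonsing_inv M hM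
  have hone : ∀ l b, ∑ a, M l a * M⁻¹ a b = if l = b then 1 else 0 := fun l b => by
    rw [← mul_apply, hMM, one_apply]
  have h2 : ∑ a, ∑ b, wedge (M j) (M k) a b * (M⁻¹ a j * M⁻¹ b k)
      = (∑ a, M j a * M⁻¹ a j) * (∑ b, M k b * M⁻¹ b k)
        - (∑ b, M j b * M⁻¹ b k) * (∑ a, M k a * M⁻¹ a j) := by
    rw [mul_comm (∑ b, M j b * M⁻¹ b k)]
    simp only [Finset.sum_mul_sum, ← Finset.sum_sub_distrib]
    refine Finset.sum_congr rfl fun e _ => Finset.sum_congr rfl fun f _ => ?_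
    unfold wedge; ring
  simp [h0, hone, hjk] at h2

/-- A metric with a null tetrad has signature `(++--)`. -/
lemma signature_of_nullTetrad {M h : Matrix (Fin 4) (Fin 4) ℝ} (hM : IsUnit M.det)
    (hh : h = Mᵀ * nullGram * M) : h.IsSymm ∧ sigPos h.toQuadraticForm' = 2 ∧
      sigNeg h.toQuadraticForm' = 2 := by
  have hN : nullGramᵀ = nullGram := by
    ext a b; fin_cases a <;> fin_cases b <;> rfl
  -- the sums and differences of the tetrad forms diagonalize the metric
  let S : Matrix (Fin 4) (Fin 4) ℝ := !![1, 1, 0, 0; 1, -1, 0, 0; 0, 0, 1, 1; 0, 0, 1, -1]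
  let w : Fin 4 → ℝ := ![1 / 2, -1 / 2, 1 / 2, -1 / 2]
  have hS : S.det = 4 := by
    simp [S, det_succ_row_zero, Fin.sum_univ_succ, Fin.succAbove]; norm_num
  have hSM : IsUnit (S * M).det := by
    rw [det_mul, hS]; exact (IsUnit.mk0 _ (by norm_num)).mul hM
  have heq : QuadraticMap.Equivalent h.toQuadraticForm' (QuadraticMap.weightedSumSquares ℝ w) := by
    refine ⟨⟨Matrix.toLinearEquiv' (S * M) ((Matrix.isUnit_iff_isUnit_det _).2 hSM).invertible, ?_⟩⟩
    intro x
    have h1 : h.toQuadraticForm' x = (M *ᵥ x) ⬝ᵥ (nullGram *ᵥ (M *ᵥ x)) := by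
      simp only [toQuadraticForm', LinearMap.BilinMap.toQuadraticMap_apply,
        toLinearMap₂'_apply', hh]
      rw [← mulVec_mulVec, ← mulVec_mulVec, dotProduct_mulVec, vecMul_transpose]
    have h2 : Matrix.toLinearEquiv' (S * M) ((Matrix.isUnit_iff_isUnit_det _).2 hSM).invertible x
        = S *ᵥ (M *ᵥ x) := by
      rw [mulVec_mulVec]; rfl
    change QuadraticMap.weightedSumSquares ℝ w (Matrix.toLinearEquiv' (S * M) _ x) = _
    rw [h1, h2, QuadraticMap.weightedSumSquares_apply]
    generalize M *ᵥ x = y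
    simp [S, w, nullGram, Fin.sum_univ_four, dotProduct, mulVec]
    ring
  refine ⟨?_, ?_, ?_⟩
  · rw [IsSymm, hh, transpose_mul, transpose_mul, transpose_transpose, hN, Matrix.mul_assoc]
  · rw [heq.sigPos_eq, QuadraticForm.sigPos_weightedSumSquares]
    have : {i | 0 < w i} = ({0, 2} : Set (Fin 4)) := by
      ext i; fin_cases i <;> simp [w]
    rw [this, Set.ncard_pair (by decide)]
  · rw [heq.sigNeg_eq, QuadraticForm.sigNeg_weightedSumSquares]
    have : {i | w i < 0} = ({1, 3} : Set (Fin 4)) := by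
      ext i; fin_cases i <;> simp [w] <;> norm_num
    rw [this, Set.ncard_pair (by decide)]

/-! ### The conformal frame of a Fefferman metric -/

/-- The action of `X` on `ℝ³ ⊕ (ℝ³)*`. -/
def dbl {R : Type*} [CommRing R] (X : Matrix (Fin 3) (Fin 3) R) :
    Matrix (Fin 3 ⊕ Fin 3) (Fin 3 ⊕ Fin 3) R :=
  fromBlocks X 0 0 (-Xᵀ)

section dbl

variable {R : Type*} [CommRing R] (X Y : Matrix (Fin 3) (Fin 3) R)

lemma dbl_add : dbl (X + Y) = dbl X + dbl Y := by
  simp only [dbl, fromBlocks_add, transpose_add, neg_add, add_zero]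

lemma dbl_sub : dbl (X - Y) = dbl X - dbl Y := by
  ext (a | a) (b | b) <;> simp [dbl]
  ring

lemma dbl_bracket : dbl (X * Y - Y * X) = dbl X * dbl Y - dbl Y * dbl X := by
  simp only [dbl, fromBlocks_multiply, transpose_sub, transpose_mul]
  ext (a | a) (b | b) <;> simp

lemma dbl_map [Algebra ℝ R] (d : Derivation ℝ R R) : (dbl X).map d = dbl (X.map d) := by
  ext (a | a) (b | b) <;> simp [dbl]

end dbl

/-- The data of a Fefferman metric: the differential algebra of the equation, the conformal factor
`ρ`, and the coefficient `c` of `dφ`, with the inverses of `ρ`, `c` and `2`. -/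
structure LeafFrame (S R : Type*) [CommRing S] [Algebra ℝ S] [CommRing R] [Algebra ℝ R] extends
    ContactFrame S R where
  ρ : R
  ρ' : R
  c : R
  c' : R
  hf : R
  ρ_mul : ρ * ρ' = 1
  c_mul : c * c' = 1
  two_mul_hf : 2 * hf = 1
  d_c : ∀ κ, d κ c = 0

namespace LeafFrame

variable {S R : Type*} [CommRing S] [Algebra ℝ S] [CommRing R] [Algebra ℝ R]
  (E : LeafFrame S R)

/-- The components of the closed 1-form `c dφ`. -/
def cdφ : Fin 4 → R := ![0, 0, 0, E.c]

lemma d_cdφ (κ μ : Fin 4) : E.d κ (E.cdφ μ) = 0 := by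
  fin_cases μ <;> simp [cdφ, E.d_c]

/-- The connection on `ℝ³ ⊕ (ℝ³)*`: the Cartan connection of the equation, twisted by `c dφ`. -/
def tractorConn (κ : Fin 4) : Matrix (Fin 3 ⊕ Fin 3) (Fin 3 ⊕ Fin 3) R :=
  dbl (E.conn κ + E.cdφ κ • 1)

theorem curvature_tractorConn (κ μ : Fin 4) :
    curvature E.d E.tractorConn κ μ = dbl (E.curvSD κ μ + E.curvASD κ μ) := by
  have hd : ∀ κ μ, (E.conn μ + E.cdφ μ • 1).map (E.d κ) = (E.conn μ).map (E.d κ) := by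
    intro κ μ
    ext a b
    simp [one_apply, E.d_cdφ, apply_ite (E.d κ)]
  have hb : (E.conn κ + E.cdφ κ • 1) * (E.conn μ + E.cdφ μ • 1)
      - (E.conn μ + E.cdφ μ • 1) * (E.conn κ + E.cdφ κ • 1)
      = E.conn κ * E.conn μ - E.conn μ * E.conn κ := by
    simp only [Matrix.add_mul, Matrix.mul_add, Matrix.smul_mul, Matrix.mul_smul, Matrix.one_mul,
      Matrix.mul_one, smul_add, smul_comm (E.cdφ κ) (E.cdφ μ)]
    abel
  rw [← E.curvature_conn, dbl_add, dbl_sub, ← hb, dbl_bracket, ← hd κ μ, ← hd μ κ, ← dbl_map,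
    ← dbl_map]
  rfl

/-- The tractor metric, minus the pairing of `ℝ³` with its dual. -/
def tractorMetric (R : Type*) [CommRing R] : Matrix (Fin 3 ⊕ Fin 3) (Fin 3 ⊕ Fin 3) R :=
  -fromBlocks 0 1 1 0

/-- The components of `d log ρ`. -/
def ups (κ : Fin 4) : R := E.ρ' * E.d κ E.ρ

/-- The 1-form that is paired with `k` in the metric. -/
def be (κ : Fin 4) : R := E.al κ + E.cdφ κ

/-- The coefficient of `e` in `d log ρ`. -/
def y1 : R := E.ups 0 + 12 * E.π E.q * E.ups 2 + E.p * E.ups 1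
  + 8 * E.π (E.P E.q) * (E.hf * E.c' * E.ups 3)

/-- Half the coefficient of `k` in `d log ρ`. -/
def y4 : R := E.hf * E.ups 1 + E.hf * E.c' * E.ups 3 * E.π (E.P (E.P E.q))

/-- Half the coefficient of `be` in `d log ρ`. -/
def y3 : R := E.hf * E.c' * E.ups 3

lemma ups_eq (κ : Fin 4) : E.ups κ
    = E.y1 * E.e κ + E.ups 2 * E.m κ + 2 * E.y3 * E.be κ + 2 * E.y4 * E.k κ := by
  have h2 := E.two_mul_hf
  have hc := E.c_mul
  fin_cases κ <;> simp [y1, y3, y4, be, ContactFrame.al, cdφ, E.m_eq, E.e_eq, E.k_eq]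
  · linear_combination E.p * E.ups 1 * h2
  · linear_combination -E.ups 1 * h2
  · linear_combination -E.ups 3 * E.c' * E.c * h2 - E.ups 3 * hc

/-- Half the square of `d log ρ` for the metric with `ρ = 1`. -/
def tt : R := E.y1 * E.ups 2 + 2 * E.y3 * E.y4

/-- The conformal frame: `ρ` times the flag of the standard basis vector and the dual basis vector
that it annihilates, its covariant derivatives, and the complementary null vector. -/
def frame : Matrix (Fin 3 ⊕ Fin 3) ConfIdx R := Matrix.of fun x B => match B with
  | .inl _ => Sum.elim ![E.ρ, 0, 0] ![0, 0, E.ρ] x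
  | .inr (.inl a) => Sum.elim ![E.ρ * E.be a + E.d a E.ρ, E.ρ * E.e a, E.ρ * E.k a]
      ![-(E.ρ * E.k a), -(E.ρ * E.m a), -(E.ρ * E.be a) + E.d a E.ρ] x
  | .inr (.inr _) => Sum.elim ![E.ρ' * (E.y4 + E.tt), E.ρ' * E.ups 2, E.ρ' * (E.hf + E.y3)]
      ![E.ρ' * (E.hf - E.y3), -(E.ρ' * E.y1), E.ρ' * (E.tt - E.y4)] x

/-- The Fefferman metric. -/
def metric : Matrix (Fin 4) (Fin 4) R := Matrix.of fun a b =>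
  E.ρ ^ 2 * (E.m a * E.e b + E.e a * E.m b + 2 * (E.k a * E.be b + E.be a * E.k b))

lemma det_metric : E.metric.det = 4 * E.c ^ 2 * E.ρ ^ 8 := by
  simp [metric, det_succ_row_zero, Fin.sum_univ_succ, Fin.succAbove, be, ContactFrame.al, cdφ,
    E.m_eq, E.e_eq, E.k_eq]
  ring

lemma isUnit_det_metric : IsUnit E.metric.det := by
  rw [det_metric, show (4 : R) = 2 * 2 by norm_num]
  have h2 : IsUnit (2 : R) := IsUnit.of_mul_eq_one _ E.two_mul_hf
  exact ((h2.mul h2).mul ((IsUnit.of_mul_eq_one _ E.c_mul).pow 2)).mul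
    ((IsUnit.of_mul_eq_one _ E.ρ_mul).pow 8)

lemma gram_apply (A B : ConfIdx) : (E.frameᵀ * tractorMetric R * E.frame) A B
    = -(E.frame (.inl 0) A * E.frame (.inr 0) B + E.frame (.inl 1) A * E.frame (.inr 1) B
      + E.frame (.inl 2) A * E.frame (.inr 2) B + E.frame (.inr 0) A * E.frame (.inl 0) B
      + E.frame (.inr 1) A * E.frame (.inl 1) B + E.frame (.inr 2) A * E.frame (.inl 2) B) := by
  rw [Matrix.mul_assoc, mul_apply]
  simp only [tractorMetric, mul_apply, Matrix.neg_apply, Fintype.sum_sum_type,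
    Fin.sum_univ_three]
  simp [one_apply]
  ring

lemma gram_frame : E.frameᵀ * tractorMetric R * E.frame = confGram E.metric := by
  have h2 := E.two_mul_hf
  have hρ := E.ρ_mul
  have hmid : ∀ a, E.ρ' * E.d a E.ρ
    = E.y1 * E.e a + E.ups 2 * E.m a + 2 * E.y3 * E.be a + 2 * E.y4 * E.k a := fun a => by
    rw [← ups_eq, ups]
  ext A B
  rw [gram_apply]
  rcases A with _ | a | _ <;> rcases B with _ | b | _ <;>
    simp [frame, confGram, metric, tt]
  · linear_combination -E.ρ * E.ρ' * h2 - hρ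
  · ring
  · linear_combination (-2 * E.hf) * hmid a + (E.y1 * E.e a + E.ups 2 * E.m a
      + 2 * E.y3 * E.be a + 2 * E.y4 * E.k a) * (hρ - h2)
  · linear_combination -E.ρ * E.ρ' * h2 - hρ
  · linear_combination (-2 * E.hf) * hmid b + (E.y1 * E.e b + E.ups 2 * E.m b
      + 2 * E.y3 * E.be b + 2 * E.y4 * E.k b) * (hρ - h2)
  · linear_combination (-2 * E.ρ' ^ 2 * (E.y1 * E.ups 2 + 2 * E.y3 * E.y4)) * h2

/-- The conformal frame of a Fefferman metric. -/
def toConfFrame : ConfFrame R (Fin 3 ⊕ Fin 3) where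
  d := E.d
  d_comm := E.d_comm
  card_eq := by simp
  J := tractorMetric R
  J_symm := by simp [tractorMetric, fromBlocks_transpose]
  map_J κ := by
    ext (a | a) (b | b) <;> simp [tractorMetric, one_apply, apply_ite (E.d κ)]
  A := E.tractorConn
  A_skew κ := by
    simp only [tractorConn, dbl, tractorMetric, fromBlocks_transpose, fromBlocks_multiply,
      fromBlocks_neg, fromBlocks_add]
    ext (a | a) (b | b) <;> simp
  g := E.metric
  isUnit_det := E.isUnit_det_metric
  N := E.frame
  gram := E.gram_frame
  deriv_zero κ x := by
    rcases x with x | x <;> fin_cases x <;>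
    simp [frame, tractorConn, dbl, mul_apply, Fin.sum_univ_three, ContactFrame.conn, be,
      one_apply] <;>
    ring

lemma torsionFree : E.toConfFrame.TorsionFree := by
  intro κ μ x
  change (curvature E.d E.tractorConn κ μ * E.frame) x (.inl ()) = 0
  rw [curvature_tractorConn]
  rcases x with x | x <;> fin_cases x <;>
  simp [dbl, frame, mul_apply, Fin.sum_univ_three, ContactFrame.curvSD, ContactFrame.curvASD]

/-- The curvature of the conformal frame, with its indices lowered. -/
theorem lowered_curvature (a b c d : Fin 4) :
    (E.frameᵀ * tractorMetric R * curvature E.d E.tractorConn c d * E.frame)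
      (.inr (.inl a)) (.inr (.inl b))
    = E.ρ ^ 2 * (E.π E.om1 * (E.sdForm a b * E.sdForm c d)
      + E.π E.om2 * (E.asdForm a b * E.asdForm c d)) := by
  rw [curvature_tractorConn, Matrix.mul_assoc, Matrix.mul_assoc, mul_apply]
  simp only [Fintype.sum_sum_type, Fin.sum_univ_three]
  simp [tractorMetric, dbl, frame, mul_apply, Fin.sum_univ_three, one_apply, ContactFrame.curvSD,
    ContactFrame.curvASD, ContactFrame.sdForm, ContactFrame.asdForm]
  ring

lemma metric_mulVec (X : Fin 4 → R) (a : Fin 4) : (E.metric *ᵥ X) a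
    = E.ρ ^ 2 * (E.m a * (E.e ⬝ᵥ X) + E.e a * (E.m ⬝ᵥ X)
      + 2 * (E.k a * (E.be ⬝ᵥ X) + E.be a * (E.k ⬝ᵥ X))) := by
  simp only [metric, mulVec, dotProduct, of_apply, Fin.sum_univ_four]
  ring

/-- The 1-form `k` with its index raised by the metric of conformal factor `ρ = 1`. -/
def kVec : Fin 4 → R := ![0, 0, 0, E.hf * E.c']

/-- The 1-form `e` with its index raised by the metric of conformal factor `ρ = 1`. -/
def eVec : Fin 4 → R := ![0, 0, 1, 0]

/-- The 1-form `m` with its index raised by the metric of conformal factor `ρ = 1`: a lift of the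
total derivative. -/
def mVec : Fin 4 → R := ![1, E.p, 12 * E.π E.q, 4 * E.c' * E.π (E.P E.q)]

lemma inv_mulVec {u X : Fin 4 → R} (h : E.metric *ᵥ X = fun a => E.ρ ^ 2 * u a) (a : Fin 4) :
    E.ρ ^ 2 * ∑ b, E.metric⁻¹ a b * u b = X a := by
  have h1 := congrFun (Matrix.mulVec_mulVec X E.metric⁻¹ E.metric) a
  rw [Matrix.nonsing_inv_mul _ E.isUnit_det_metric, Matrix.one_mulVec, h] at h1
  rw [← h1, mulVec, dotProduct, Finset.mul_sum]
  exact Finset.sum_congr rfl fun b _ => by ring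

lemma inv_mulVec_k (a : Fin 4) : E.ρ ^ 2 * ∑ b, E.metric⁻¹ a b * E.k b = E.kVec a := by
  refine E.inv_mulVec (funext fun a => ?_) a
  have h2 := E.two_mul_hf
  have hc := E.c_mul
  rw [metric_mulVec]
  simp [kVec, dotProduct, Fin.sum_univ_four, be, ContactFrame.al, cdφ, E.m_eq, E.e_eq, E.k_eq]
  linear_combination E.ρ ^ 2 * (![-E.p, 1, 0, 0] a) * (hc + E.c * E.c' * h2)

lemma inv_mulVec_e (a : Fin 4) : E.ρ ^ 2 * ∑ b, E.metric⁻¹ a b * E.e b = eVec a := by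
  refine E.inv_mulVec (funext fun a => ?_) a
  rw [metric_mulVec]
  simp [eVec, dotProduct, Fin.sum_univ_four, be, ContactFrame.al, cdφ, E.m_eq, E.e_eq, E.k_eq]

lemma inv_mulVec_m (a : Fin 4) : E.ρ ^ 2 * ∑ b, E.metric⁻¹ a b * E.m b = E.mVec a := by
  refine E.inv_mulVec (funext fun a => ?_) a
  have hc := E.c_mul
  rw [metric_mulVec]
  simp [mVec, dotProduct, Fin.sum_univ_four, be, ContactFrame.al, cdφ, E.m_eq, E.e_eq, E.k_eq]
  linear_combination E.ρ ^ 2 * (8 * (![-E.p, 1, 0, 0] a) * E.π (E.P E.q)) * hc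

lemma ricciFree : E.toConfFrame.RicciFree := by
  intro b ν
  have h : ∀ a, (E.toConfFrame.Ninv * curvature E.toConfFrame.d E.toConfFrame.A a ν
      * E.toConfFrame.N) (.inr (.inl a)) (.inr (.inl b))
      = E.π E.om1 * (E.sdForm a ν * (E.kVec a * E.e b - (eVec a : R) * E.k b))
        + E.π E.om2 * (E.asdForm a ν * (E.mVec a * E.k b - E.kVec a * E.m b)) := by
    intro a
    have h1 : E.toConfFrame.Ninv * curvature E.toConfFrame.d E.toConfFrame.A a ν
        * E.toConfFrame.N = confGram E.metric⁻¹
          * (E.frameᵀ * tractorMetric R * curvature E.d E.tractorConn a ν * E.frame) := by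
      simp only [ConfFrame.Ninv, Matrix.mul_assoc]
      rfl
    rw [h1, mul_apply]
    simp only [Fintype.sum_sum_type, confGram, of_apply, zero_mul, Finset.sum_const_zero, zero_add,
      add_zero, lowered_curvature]
    rw [← E.inv_mulVec_k, ← E.inv_mulVec_e, ← E.inv_mulVec_m]
    simp only [ContactFrame.sdForm, ContactFrame.asdForm, Fin.sum_univ_four]
    ring
  change ∑ a, (E.toConfFrame.Ninv * curvature E.toConfFrame.d E.toConfFrame.A a ν
      * E.toConfFrame.N) (.inr (.inl a)) (.inr (.inl b)) = 0
  simp only [h, Fin.sum_univ_four]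
  simp [kVec, eVec, mVec, ContactFrame.sdForm, ContactFrame.asdForm, E.m_eq, E.e_eq, E.k_eq]
  ring

/-- The covariant exterior derivative of the dual of the curvature, on `ℝ³ ⊕ (ℝ³)*`. -/
theorem yangMills_tractorConn (κ μ ν : Fin 4) :
    let G : Fin 4 → Fin 4 → Matrix (Fin 3 ⊕ Fin 3) (Fin 3 ⊕ Fin 3) R :=
      fun μ ν => dbl (E.curvSD μ ν - E.curvASD μ ν)
    let Y : Fin 4 → Fin 4 → Fin 4 → Matrix (Fin 3 ⊕ Fin 3) (Fin 3 ⊕ Fin 3) R := fun κ μ ν =>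
      (G μ ν).map (E.d κ) + (E.tractorConn κ * G μ ν - G μ ν * E.tractorConn κ)
    Y κ μ ν + Y μ ν κ + Y ν κ μ
      = dbl ((2 * E.contactVol κ μ ν) • !![0, 0, E.π (E.P (E.P E.om1)); 0, 0, 0; 0, 0, 0]) := by
  intro G Y
  have hY : ∀ κ μ ν, Y κ μ ν = dbl ((E.curvSD μ ν - E.curvASD μ ν).map (E.d κ)
      + (E.conn κ * (E.curvSD μ ν - E.curvASD μ ν)
        - (E.curvSD μ ν - E.curvASD μ ν) * E.conn κ)) := by
    intro κ μ ν
    have hb : ∀ X : Matrix (Fin 3) (Fin 3) R, (E.conn κ + E.cdφ κ • 1) * X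
        - X * (E.conn κ + E.cdφ κ • 1) = E.conn κ * X - X * E.conn κ := by
      intro X
      simp only [Matrix.add_mul, Matrix.mul_add, Matrix.smul_mul, Matrix.mul_smul, Matrix.one_mul,
        Matrix.mul_one]
      abel
    simp only [Y, G]
    rw [dbl_add, ← hb, dbl_bracket, dbl_map]
    rfl
  rw [hY, hY, hY, ← dbl_add, ← dbl_add, E.yangMills_conn]

end LeafFrame

/-! ### The frame of the equation on the leaf space -/

/-- The projection `(x, y, p, φ) ↦ (x, y, p)` of the leaf space to the first jet space. -/
def jetProj : (Fin 4 → ℝ) →L[ℝ] (Fin 3 → ℝ) :=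
  ContinuousLinearMap.pi fun k => ContinuousLinearMap.proj k.castSucc

lemma jetProj_apply (q : Fin 4 → ℝ) (k : Fin 3) : jetProj q k = q k.castSucc := rfl

namespace smoothAlg

variable {U : Opens (Fin 3 → ℝ)} {V : Opens (Fin 4 → ℝ)} (h : ∀ q ∈ V, jetProj q ∈ U)

/-- The pullback of functions from the first jet space to the leaf space. -/
def pull : smoothAlg U →+* smoothAlg V where
  toFun f := ⟨fun q => f.1 ⟨jetProj q, h q q.2⟩, fun y => rep f (jetProj y),
    (contDiffOn_rep f).comp jetProj.contDiff.contDiffOn h, fun _ => (rep_apply f _).symm⟩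
  map_one' := rfl
  map_mul' _ _ := rfl
  map_zero' := rfl
  map_add' _ _ := rfl

lemma pder_pull_apply (κ : Fin 4) (f : smoothAlg U) (q : V) :
    (pder κ (pull h f)).1 q = fderiv ℝ (rep f) (jetProj q) (jetProj (Pi.single κ 1)) := by
  rw [pder_apply κ (pull h f) (F := rep f ∘ jetProj) (fun x => (rep_apply f _).symm), pd,
    fderiv_comp (x := (q : Fin 4 → ℝ)) (differentiableAt_rep f ⟨jetProj q, h q q.2⟩)
      jetProj.differentiableAt,
    ContinuousLinearMap.fderiv]
  rfl

lemma pder_pull_castSucc (k : Fin 3) (f : smoothAlg U) :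
    pder k.castSucc (pull h f) = pull h (pder k f) := by
  ext q
  have h1 : jetProj (Pi.single k.castSucc 1) = Pi.single k 1 := by
    ext j
    simp [jetProj_apply, Pi.single_apply]
  rw [pder_pull_apply, h1]
  rfl

lemma pder_pull_last (f : smoothAlg U) : pder 3 (pull h f) = 0 := by
  ext q
  have h1 : jetProj (Pi.single 3 1) = 0 := by
    ext j
    fin_cases j <;> simp [jetProj_apply]
  rw [pder_pull_apply, h1, map_zero]
  rfl

/-- The coordinate `p` on the first jet space. -/
def pCoord (U : Opens (Fin 3 → ℝ)) : smoothAlg U :=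
  mk (fun u => u 2) (contDiff_apply ℝ ℝ 2).contDiffOn

lemma pder_pCoord (μ : Fin 3) : pder μ (pCoord U) = if μ = 2 then 1 else 0 := by
  ext u
  rw [pder_apply μ (pCoord U) (F := fun u => u 2) (fun x => rfl), pd,
    show (fun u : Fin 3 → ℝ => u 2) = (ContinuousLinearMap.proj 2 : (Fin 3 → ℝ) →L[ℝ] ℝ) from rfl,
    ContinuousLinearMap.fderiv]
  fin_cases μ <;> simp

/-- The total derivative as a derivation. -/
def totalDer (Q : smoothAlg U) : Derivation ℝ (smoothAlg U) (smoothAlg U) :=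
  pder 0 + pCoord U • pder 1 + Q • pder 2

lemma totalDer_eq (Q f : smoothAlg U) :
    totalDer Q f = pder 0 f + pCoord U * pder 1 f + Q * pder 2 f := rfl

lemma totalDer_apply (Q f : smoothAlg U) {q F : (Fin 3 → ℝ) → ℝ} (hQ : ∀ x : U, Q.1 x = q x)
    (hf : ∀ x : U, f.1 x = F x) (x : U) : (totalDer Q f).1 x = totalD q F x := by
  rw [totalD, ← hQ, ← pder_apply 0 f hf, ← pder_apply 1 f hf, ← pder_apply 2 f hf]
  rfl

end smoothAlg

lemma add_zero_mul {T : Type*} [CommRing T] (a b : T) : a + 0 * b = a := by ring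

section Algebra

variable {T : Type*} [CommRing T] [Algebra ℝ T]

lemma mul_one_add_mul_add_mul_zero {T : Type*} [CommRing T] (m e k q : T) :
    m * 1 + e * q + k * 0 = m + q * e := by
  ring

lemma derivation_vecE (d : Derivation ℝ T T) (μ : Fin 4) :
    d ((![1, 0, 0, 0] : Fin 4 → T) μ) = 0 := by
  fin_cases μ <;> simp

lemma derivation_vecM (d : Derivation ℝ T T) (a : T) (μ : Fin 4) :
    d ((![-a, 0, 1, 0] : Fin 4 → T) μ) = -d a * (![1, 0, 0, 0] : Fin 4 → T) μ := by
  fin_cases μ <;> simp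

lemma derivation_vecK (d : Derivation ℝ T T) (a : T) (μ : Fin 4) :
    d ((![-a, 1, 0, 0] : Fin 4 → T) μ) = -d a * (![1, 0, 0, 0] : Fin 4 → T) μ := by
  fin_cases μ <;> simp

lemma derivation_ofNat_mul (d : Derivation ℝ T T) (c : ℕ) [c.AtLeastTwo] (a : T) :
    d (ofNat(c) * a) = ofNat(c) * d a := by
  rw [ContactFrame.derivation_mul, ContactFrame.derivation_ofNat, zero_mul, add_zero]

lemma algebraMap_mul_eq_one {a b : ℝ} (h : a * b = 1) :
    algebraMap ℝ T a * algebraMap ℝ T b = 1 := by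
  rw [← map_mul, h, map_one]

lemma neg_div_three_mul {i : ℝ} (hi : i ≠ 0) : -i / 3 * (-3 / i) = 1 := by field_simp

lemma two_mul_algebraMap : (2 : T) * algebraMap ℝ T (1 / 2) = 1 := by
  rw [← map_ofNat (algebraMap ℝ T)]
  exact algebraMap_mul_eq_one (by norm_num)

end Algebra

section leafFrame

open smoothAlg

variable {U : Opens (Fin 3 → ℝ)} {V : Opens (Fin 4 → ℝ)} (h : ∀ q ∈ V, jetProj q ∈ U)
  (Q : smoothAlg U)

lemma twelve_mul_smul {n : ℕ} {W : Opens (Fin n → ℝ)} (f : smoothAlg W) :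
    12 * ((1 / 12 : ℝ) • f) = f := by
  ext u
  change 12 * ((1 / 12 : ℝ) * f.1 u) = f.1 u
  ring

lemma twelve_mul_pder (μ : Fin 3) : 12 * pder μ ((1 / 12 : ℝ) • Q) = pder μ Q := by
  rw [Derivation.map_smul, twelve_mul_smul]

lemma twelve_mul_pull : 12 * pull h ((1 / 12 : ℝ) • Q) = pull h Q := by
  rw [← map_ofNat (pull h), ← map_mul, twelve_mul_smul]

/-- The components of `dp - Q dx`. -/
def leafM : Fin 4 → smoothAlg V := ![-(12 * pull h ((1 / 12 : ℝ) • Q)), 0, 1, 0]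

/-- The components of `dx`. -/
def leafE (V : Opens (Fin 4 → ℝ)) : Fin 4 → smoothAlg V := ![1, 0, 0, 0]

/-- The components of `dy - p dx`. -/
def leafK : Fin 4 → smoothAlg V := ![-pull h (pCoord U), 1, 0, 0]

lemma pder_leafE (κ μ : Fin 4) : pder κ (leafE V μ) = 0 := derivation_vecE _ _

lemma pder_pull (κ : Fin 4) (f : smoothAlg U) : pder κ (pull h f)
    = leafM h Q κ * pull h (pder 2 f) + leafE V κ * pull h (totalDer Q f)
      + leafK h κ * pull h (pder 1 f) := by
  rw [totalDer_eq, leafM, leafE, leafK, twelve_mul_pull, map_add, map_add, map_mul, map_mul]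
  have h0 : pder 0 (pull h f) = pull h (pder 0 f) := pder_pull_castSucc h 0 f
  have h1 : pder 1 (pull h f) = pull h (pder 1 f) := pder_pull_castSucc h 1 f
  have h2 : pder 2 (pull h f) = pull h (pder 2 f) := pder_pull_castSucc h 2 f
  have h3 : pder 3 (pull h f) = 0 := pder_pull_last h f
  generalize pull h (pder 0 f) = f0 at *
  generalize pull h (pder 1 f) = f1 at *
  generalize pull h (pder 2 f) = f2 at *
  fin_cases κ <;> simp only [Fin.zero_eta, Fin.mk_one, Fin.reduceFinMk, cons_val_zero,
    cons_val_one, cons_val, h0, h1, h2, h3] <;> ring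

lemma pder_totalDer (μ : Fin 3) (f : smoothAlg U) : pder μ (totalDer Q f)
    = totalDer Q (pder μ f) + pder μ (pCoord U) * pder 1 f + pder μ Q * pder 2 f := by
  rw [totalDer_eq, totalDer_eq, map_add, map_add, ContactFrame.derivation_mul,
    ContactFrame.derivation_mul, pder_comm μ 0, pder_comm μ 1, pder_comm μ 2]
  ring

lemma totalDer_pCoord : totalDer Q (pCoord U) = Q := by
  rw [totalDer_eq, pder_pCoord, pder_pCoord, pder_pCoord, if_neg (by decide), if_neg (by decide),
    if_pos rfl]
  ring

/-- The frame of the equation `y'' = Q` over the part `V` of the leaf space, with the conformal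
factor `r`. -/
def leafFrame (r : (smoothAlg V)ˣ) {i : ℝ} (hi : i ≠ 0) :
    LeafFrame (smoothAlg U) (smoothAlg V) where
  q := (1 / 12 : ℝ) • Q
  P := pder 2
  D := totalDer Q
  Y := pder 1
  P_Y f := pder_comm _ _ f
  P_D f := by
    rw [twelve_mul_pder Q 2, pder_totalDer Q 2 f, pder_pCoord 2, if_pos rfl, one_mul]
  Y_D f := by
    rw [twelve_mul_pder Q 1, pder_totalDer Q 1 f, pder_pCoord 1, if_neg (by decide), add_zero_mul]
  π := pull h
  d := pder
  p := pull h (pCoord U)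
  m := leafM h Q
  e := leafE V
  k := leafK h
  m_eq := rfl
  e_eq := rfl
  k_eq := rfl
  d_comm := pder_comm
  d_π κ f := pder_pull h Q κ f
  d_m κ μ := by
    rw [← pder_pull, leafM, derivation_vecM, derivation_ofNat_mul]
    rfl
  d_e := pder_leafE
  d_k κ μ := by
    rw [leafK, derivation_vecK, pder_pull h Q, totalDer_pCoord, pder_pCoord, pder_pCoord,
      if_pos rfl, if_neg (by decide), map_one, map_zero, twelve_mul_pull,
      mul_one_add_mul_add_mul_zero]
    rfl
  ρ := r
  ρ' := ↑r⁻¹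
  c := algebraMap ℝ _ (-i / 3)
  c' := algebraMap ℝ _ (-3 / i)
  hf := algebraMap ℝ _ (1 / 2)
  ρ_mul := r.mul_inv
  c_mul := algebraMap_mul_eq_one (neg_div_three_mul hi)
  two_mul_hf := two_mul_algebraMap
  d_c κ := Derivation.map_algebraMap _ _

end leafFrame

/-! ### Fefferman metrics -/

lemma bilinG_eq_tetrad (i : ℝ) (Q : (Fin 3 → ℝ) → ℝ) (z v w : Fin 8 → ℝ) :
    bilinG i Q z v w = theta1 i Q z v * theta2 i z w + theta2 i z v * theta1 i Q z w
      + (theta3 i z v * theta4 i Q z w + theta4 i Q z v * theta3 i z w) := by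
  simp only [bilinG, theta4, _root_.smul_apply, _root_.sub_apply,
    smul_eq_mul]
  ring

lemma theta1_apply (i : ℝ) (Q : (Fin 3 → ℝ) → ℝ) (z v : Fin 8 → ℝ) :
    theta1 i Q z v = z 3 * Real.exp (i * z 4)
      * ((v 2 - Q (base z) * v 0) - i * z 5 * (v 1 - z 2 * v 0)) := by
  simp [theta1, formM, formL, dz]
  ring

lemma theta2_apply (i : ℝ) (z v : Fin 8 → ℝ) :
    theta2 i z v = z 3 * Real.exp (-(i * z 4)) * (v 0 - i * z 6 * (v 1 - z 2 * v 0)) := by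
  simp [theta2, formMbar, formL, dz]
  ring

lemma theta3_apply (i : ℝ) (z v : Fin 8 → ℝ) :
    theta3 i z v = -i * z 3 ^ 2 * (v 1 - z 2 * v 0) := by
  simp [theta3, formL, dz]
  ring

/-- The dependence of the metric on the fibre coordinates: only the conformal factor `ρ` is
left. -/
lemma bilinG_eq {i : ℝ} (hi : i ≠ 0) (Q : (Fin 3 → ℝ) → ℝ) {z : Fin 8 → ℝ} (hz : z 3 ≠ 0)
    (v w : Fin 8 → ℝ) :
    bilinG i Q z v w = z 3 ^ 2 *
      ((v 2 - Q (base z) * v 0) * w 0 + v 0 * (w 2 - Q (base z) * w 0)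
        + 2 * ((v 1 - z 2 * v 0) * (-(pd 2 Q (base z) / 3 * w 0
            + pd 2 (pd 2 Q) (base z) / 12 * (w 1 - z 2 * w 0)) + -i / 3 * w 4)
          + (-(pd 2 Q (base z) / 3 * v 0
            + pd 2 (pd 2 Q) (base z) / 12 * (v 1 - z 2 * v 0)) + -i / 3 * v 4)
            * (w 1 - z 2 * w 0))) := by
  have he : Real.exp (i * z 4) ≠ 0 := Real.exp_ne_zero _
  have h1 : ∀ x, 1 / (3 * i) * (Omega2 i Q z x - Omega2bar i Q z x) = theta4 i Q z x := fun x => rfl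
  have h4 : ∀ x, z 3 ^ 2 * -i * theta4 i Q z x = -i * z 3 ^ 2 * (2 / 3 * x 4)
      - z 3 ^ 2 * i * ((i * z 5 * z 6 + pd 2 (pd 2 Q) (base z) / (6 * i)) * (x 1 - z 2 * x 0)
        - z 6 * (x 2 - Q (base z) * x 0) - z 5 * x 0 + 2 * pd 2 Q (base z) / (3 * i) * x 0) := by
    intro x
    simp only [theta4, Omega2, Omega2bar, _root_.smul_apply,
      _root_.sub_apply, _root_.add_apply, smul_eq_mul, theta1_apply,
      theta2_apply, theta3_apply, dz, ContinuousLinearMap.proj_apply, Real.exp_neg]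
    field_simp
    ring
  have h5 : ∀ x y, theta3 i z x * theta4 i Q z y
      = (x 1 - z 2 * x 0) * (z 3 ^ 2 * -i * theta4 i Q z y) := fun x y => by
    rw [theta3_apply]; ring
  rw [bilinG_eq_tetrad, mul_comm (theta4 i Q z v), h5, h5, h4, h4]
  simp only [theta1_apply, theta2_apply, Real.exp_neg]
  field_simp
  ring

lemma section_apply {U : Set (Fin 3 → ℝ)} {V : Set (Fin 4 → ℝ)} {s : (Fin 4 → ℝ) → (Fin 8 → ℝ)}
    (hs : IsLeafSection U V s) {q : Fin 4 → ℝ} (hq : q ∈ V) :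
    s q 0 = q 0 ∧ s q 1 = q 1 ∧ s q 2 = q 2 ∧ s q 4 = q 3 := by
  have h := hs.leafProj_eq q hq
  exact ⟨congrFun h 0, congrFun h 1, congrFun h 2, congrFun h 3⟩

lemma base_section {U : Set (Fin 3 → ℝ)} {V : Set (Fin 4 → ℝ)} {s : (Fin 4 → ℝ) → (Fin 8 → ℝ)}
    (hs : IsLeafSection U V s) {q : Fin 4 → ℝ} (hq : q ∈ V) : base (s q) = jetProj q := by
  obtain ⟨h0, h1, h2, -⟩ := section_apply hs hq
  ext k
  fin_cases k
  exacts [h0, h1, h2]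

lemma jetProj_mem {U : Set (Fin 3 → ℝ)} {V : Set (Fin 4 → ℝ)} {s : (Fin 4 → ℝ) → (Fin 8 → ℝ)}
    (hs : IsLeafSection U V s) {q : Fin 4 → ℝ} (hq : q ∈ V) : jetProj q ∈ U := by
  rw [← base_section hs hq]
  exact (hs.mem_bundle q hq).1

lemma fderiv_section {U : Set (Fin 3 → ℝ)} {V : Set (Fin 4 → ℝ)}
    {s : (Fin 4 → ℝ) → (Fin 8 → ℝ)}
    (hs : IsLeafSection U V s) {q : Fin 4 → ℝ} (hq : q ∈ V) (v : Fin 4 → ℝ) :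
    fderiv ℝ s q v 0 = v 0 ∧ fderiv ℝ s q v 1 = v 1 ∧ fderiv ℝ s q v 2 = v 2
      ∧ fderiv ℝ s q v 4 = v 3 := by
  have hV := hs.isOpen.mem_nhds hq
  have hd : DifferentiableAt ℝ s q := (hs.smooth.contDiffAt hV).differentiableAt (by simp)
  have key : ∀ (j : Fin 8) (k : Fin 4), (∀ y ∈ V, s y j = y k) → fderiv ℝ s q v j = v k := by
    intro j k h
    have h1 : (fun y => s y j) =ᶠ[nhds q] fun y => y k := Filter.eventuallyEq_of_mem hV h
    have h2 : fderiv ℝ (fun y => s y j) q v = fderiv ℝ s q v j := by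
      rw [fderiv_apply hd]; rfl
    rw [← h2, h1.fderiv_eq]
    exact congrArg (fun L : (Fin 4 → ℝ) →L[ℝ] ℝ => L v)
      (ContinuousLinearMap.proj (R := ℝ) (φ := fun _ : Fin 4 => ℝ) k).fderiv
  exact ⟨key 0 0 fun y hy => (section_apply hs hy).1, key 1 1 fun y hy => (section_apply hs hy).2.1,
    key 2 2 fun y hy => (section_apply hs hy).2.2.1,
    key 4 3 fun y hy => (section_apply hs hy).2.2.2⟩

namespace ContactFrame

variable {S R : Type*} [CommRing S] [Algebra ℝ S] [CommRing R] [Algebra ℝ R]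
  (E : ContactFrame S R)

lemma six_mul_om1 {Q : S} (hQ : 12 * E.q = Q) : 6 * E.om1
    = E.D (E.D (E.P (E.P Q))) - 4 * E.D (E.Y (E.P Q)) - E.D (E.P (E.P Q)) * E.P Q
      + 4 * E.P Q * E.Y (E.P Q) - 3 * E.P (E.P Q) * E.Y Q + 6 * E.Y (E.Y Q) := by
  subst hQ
  simp only [om1, derivation_mul, derivation_ofNat, zero_mul, add_zero, E.P_Y]
  ring

lemma six_mul_om2 {Q : S} (hQ : 12 * E.q = Q) : 6 * E.om2 = E.P (E.P (E.P (E.P Q))) := by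
  subst hQ
  simp only [om2, derivation_mul, derivation_ofNat, zero_mul, add_zero]
  ring

end ContactFrame

section FramedSection

open smoothAlg

variable {i : ℝ} (hi : i ≠ 0) {U : Set (Fin 3 → ℝ)} (hU : IsOpen U) {Q : (Fin 3 → ℝ) → ℝ}
  (hQ : ContDiffOn ℝ ∞ Q U) {V : Set (Fin 4 → ℝ)} {s : (Fin 4 → ℝ) → (Fin 8 → ℝ)}
  (hs : IsLeafSection U V s)

/-- The conformal factor of the Fefferman metric, as an invertible function. -/
def sectionRho : (smoothAlg (⟨V, hs.isOpen⟩ : Opens (Fin 4 → ℝ)))ˣ :=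
  (isUnit_of_ne_zero (smoothAlg.mk (V := ⟨V, hs.isOpen⟩) (fun q => s q 3)
      (contDiffOn_pi.1 hs.smooth 3))
    fun x => (hs.mem_bundle x x.2).2).unit

/-- The frame that belongs to a Fefferman metric. -/
def sectionFrame : LeafFrame (smoothAlg (⟨U, hU⟩ : Opens (Fin 3 → ℝ)))
    (smoothAlg (⟨V, hs.isOpen⟩ : Opens (Fin 4 → ℝ))) :=
  leafFrame (fun _ hq => jetProj_mem hs hq) (smoothAlg.mk Q hQ) (sectionRho hs) hi

variable (q : (⟨V, hs.isOpen⟩ : Opens (Fin 4 → ℝ)))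

lemma sectionFrame_ρ : (sectionFrame hi hU hQ hs).ρ.1 q = s q 3 := rfl

lemma sectionFrame_m (μ : Fin 4) : ((sectionFrame hi hU hQ hs).m μ).1 q
    = (Pi.single μ 1 : Fin 4 → ℝ) 2 - Q (jetProj q) * (Pi.single μ 1 : Fin 4 → ℝ) 0 := by
  have h : (sectionFrame hi hU hQ hs).m
      = ![-pull (fun _ hq => jetProj_mem hs hq) (smoothAlg.mk (V := ⟨U, hU⟩) Q hQ), 0, 1, 0] := by
    rw [← twelve_mul_pull]; rfl
  rw [h]
  fin_cases μ
  · refine Eq.trans (b := -Q (jetProj q)) rfl ?_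
    simp
  · refine Eq.trans (b := 0) rfl ?_
    simp
  · refine Eq.trans (b := 1) rfl ?_
    simp
  · refine Eq.trans (b := 0) rfl ?_
    simp

lemma sectionFrame_e (μ : Fin 4) : ((sectionFrame hi hU hQ hs).e μ).1 q
    = (Pi.single μ 1 : Fin 4 → ℝ) 0 := by
  have h : (sectionFrame hi hU hQ hs).e = ![1, 0, 0, 0] := rfl
  rw [h]
  fin_cases μ
  · refine Eq.trans (b := 1) rfl ?_
    simp
  all_goals
    refine Eq.trans (b := 0) rfl ?_
    simp

lemma sectionFrame_k (μ : Fin 4) : ((sectionFrame hi hU hQ hs).k μ).1 q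
    = (Pi.single μ 1 : Fin 4 → ℝ) 1 - q.1 2 * (Pi.single μ 1 : Fin 4 → ℝ) 0 := by
  have h : (sectionFrame hi hU hQ hs).k
      = ![-pull (fun _ hq => jetProj_mem hs hq) (pCoord ⟨U, hU⟩), 1, 0, 0] := rfl
  rw [h]
  fin_cases μ
  · refine Eq.trans (b := -q.1 2) rfl ?_
    simp
  · refine Eq.trans (b := 1) rfl ?_
    simp
  all_goals
    refine Eq.trans (b := 0) rfl ?_
    simp

lemma sectionFrame_cdφ (μ : Fin 4) : ((sectionFrame hi hU hQ hs).cdφ μ).1 q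
    = -i / 3 * (Pi.single μ 1 : Fin 4 → ℝ) 3 := by
  have h : (sectionFrame hi hU hQ hs).cdφ = ![0, 0, 0, algebraMap ℝ _ (-i / 3)] := rfl
  rw [h]
  fin_cases μ
  · refine Eq.trans (b := 0) rfl ?_
    simp
  · refine Eq.trans (b := 0) rfl ?_
    simp
  · refine Eq.trans (b := 0) rfl ?_
    simp
  · refine Eq.trans (b := -i / 3) rfl ?_
    simp

lemma twelve_mul_q : 12 * (sectionFrame hi hU hQ hs).q = smoothAlg.mk Q hQ := twelve_mul_smul _

lemma sectionFrame_Pq : ((sectionFrame hi hU hQ hs).π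
    ((sectionFrame hi hU hQ hs).P (sectionFrame hi hU hQ hs).q)).1 q
      = pd 2 Q (jetProj q) / 12 := by
  have h : (sectionFrame hi hU hQ hs).P (sectionFrame hi hU hQ hs).q
      = (1 / 12 : ℝ) • pder 2 (smoothAlg.mk (V := ⟨U, hU⟩) Q hQ) := Derivation.map_smul _ _ _
  rw [h]
  change (1 / 12 : ℝ) * (pder 2 (smoothAlg.mk (V := ⟨U, hU⟩) Q hQ)).1 ⟨jetProj q, _⟩ = _
  rw [pder_apply 2 (smoothAlg.mk (V := ⟨U, hU⟩) Q hQ) (F := Q) (fun x => rfl)]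
  ring

lemma sectionFrame_PPq : ((sectionFrame hi hU hQ hs).π
    ((sectionFrame hi hU hQ hs).P ((sectionFrame hi hU hQ hs).P (sectionFrame hi hU hQ hs).q))).1 q
      = pd 2 (pd 2 Q) (jetProj q) / 12 := by
  have h : (sectionFrame hi hU hQ hs).P
      ((sectionFrame hi hU hQ hs).P (sectionFrame hi hU hQ hs).q)
      = (1 / 12 : ℝ) • pder 2 (pder 2 (smoothAlg.mk (V := ⟨U, hU⟩) Q hQ)) :=
    (congrArg _ (Derivation.map_smul _ _ _)).trans (Derivation.map_smul _ _ _)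
  rw [h]
  change (1 / 12 : ℝ) * (pder 2 (pder 2 (smoothAlg.mk (V := ⟨U, hU⟩) Q hQ))).1 ⟨jetProj q, _⟩ = _
  rw [pder_apply 2 _ (F := pd 2 Q)
    (pder_apply 2 (smoothAlg.mk (V := ⟨U, hU⟩) Q hQ) (F := Q) (fun x => rfl))]
  ring

lemma sectionFrame_be (μ : Fin 4) : ((sectionFrame hi hU hQ hs).be μ).1 q
    = -(pd 2 Q (jetProj q) / 3 * (Pi.single μ 1 : Fin 4 → ℝ) 0
      + pd 2 (pd 2 Q) (jetProj q) / 12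
        * ((Pi.single μ 1 : Fin 4 → ℝ) 1 - q.1 2 * (Pi.single μ 1 : Fin 4 → ℝ) 0))
      + -i / 3 * (Pi.single μ 1 : Fin 4 → ℝ) 3 := by
  rw [← sectionFrame_cdφ hi hU hQ hs, ← sectionFrame_k hi hU hQ hs, ← sectionFrame_e hi hU hQ hs]
  have h := sectionFrame_Pq hi hU hQ hs q
  have h' := sectionFrame_PPq hi hU hQ hs q
  rw [← h', show pd 2 Q (jetProj q) / 3 = 4 * (pd 2 Q (jetProj q) / 12) by ring, ← h]
  rfl

lemma sectionFrame_om1 (u : (⟨U, hU⟩ : Opens (Fin 3 → ℝ))) :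
    (sectionFrame hi hU hQ hs).om1.1 u = w₁ Q u / 6 := by
  have h := congrArg (eval u) ((sectionFrame hi hU hQ hs).six_mul_om1 (twelve_mul_q hi hU hQ hs))
  have hq : ∀ x : (⟨U, hU⟩ : Opens (Fin 3 → ℝ)),
      (smoothAlg.mk (V := ⟨U, hU⟩) Q hQ).1 x = Q x := fun _ => rfl
  have hp := pder_apply 2 _ hq
  have hy := pder_apply 1 _ hq
  have hpp := pder_apply 2 _ hp
  have hyp := pder_apply 1 _ hp
  have hyy := pder_apply 1 _ hy
  have hDpp := totalDer_apply (smoothAlg.mk (V := ⟨U, hU⟩) Q hQ) _ hq hpp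
  have hDyp := totalDer_apply (smoothAlg.mk (V := ⟨U, hU⟩) Q hQ) _ hq hyp
  have hDDpp := totalDer_apply (smoothAlg.mk (V := ⟨U, hU⟩) Q hQ) _ hq hDpp
  have h6 : 6 * (sectionFrame hi hU hQ hs).om1.1 u = w₁ Q u := by
    rw [w₁, ← hDDpp, ← hDyp, ← hDpp, ← hp, ← hyp, ← hpp, ← hy, ← hyy]
    exact h
  rw [← h6]
  ring

lemma sectionFrame_om2 (u : (⟨U, hU⟩ : Opens (Fin 3 → ℝ))) :
    (sectionFrame hi hU hQ hs).om2.1 u = w₂ Q u / 6 := by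
  have h := congrArg (eval u) ((sectionFrame hi hU hQ hs).six_mul_om2 (twelve_mul_q hi hU hQ hs))
  have hq : ∀ x : (⟨U, hU⟩ : Opens (Fin 3 → ℝ)),
      (smoothAlg.mk (V := ⟨U, hU⟩) Q hQ).1 x = Q x := fun _ => rfl
  have hp := pder_apply 2 _ (pder_apply 2 _ (pder_apply 2 _ (pder_apply 2 _ hq)))
  have h6 : 6 * (sectionFrame hi hU hQ hs).om2.1 u = w₂ Q u := by
    rw [w₂, ← hp]
    exact h
  rw [← h6]
  ring

end FramedSection

/-! ### Self-duality and the Baston–Mason conditions -/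

lemma dbl_smul {R : Type*} [CommRing R] (r : R) (X : Matrix (Fin 3) (Fin 3) R) :
    dbl (r • X) = r • dbl X := by
  ext (a | a) (b | b) <;> simp [dbl]

lemma evalM_smul {n : ℕ} {V : Opens (Fin n → ℝ)} {l m : Type*} (q : V) (r : smoothAlg V)
    (M : Matrix l m (smoothAlg V)) : evalM q (r • M) = r.1 q • evalM q M := by
  ext a b; rfl

/-- By the Bianchi identity, `∂_p² w₁` is a combination of derivatives of `w₂`. If `w₁ w₂ = 0`, each
of these has zero product with `∂_p² w₁`, so that the square of `∂_p² w₁` vanishes. -/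
lemma ContactFrame.P_P_om1_eq_zero {U : Opens (Fin 3 → ℝ)} {R : Type*} [CommRing R] [Algebra ℝ R]
    (E : ContactFrame (smoothAlg U) R) (h : E.om1 * E.om2 = 0) : E.P (E.P E.om1) = 0 := by
  have key : ∀ (c b x d p y : smoothAlg U), c + (x + 12 * p * d + 12 * y * b) = 0 →
      b * c = 0 → d * c = 0 → x * c = 0 → c * c = 0 := by
    intro c b x d p y hb h1 h2 h3
    linear_combination c * hb - h3 - 12 * p * h2 - 12 * y * h1
  have h1 : E.om2 * E.P (E.P E.om1) = 0 := by
    rw [mul_comm]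
    exact smoothAlg.derivation_mul_eq_zero _ (smoothAlg.derivation_mul_eq_zero _ h)
  have h2 : E.om3 * E.P (E.P E.om1) = 0 := by
    have h4 := smoothAlg.derivation_mul_eq_zero E.D h1
    have h5 : ∀ x y b c : smoothAlg U, x * c = 0 → b * c = 0 → -(x + 24 * y * b) * c = 0 := by
      intro x y b c hx hb
      linear_combination -hx - 24 * y * hb
    exact h5 _ _ _ _ h4 h1
  have h3 := key _ _ _ _ _ _ E.bianchi h1 h2 (smoothAlg.derivation_mul_eq_zero E.D h2)
  ext x
  exact mul_self_eq_zero.1 (congrArg (fun k : smoothAlg U => k.1 x) h3)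

namespace LeafFrame

section

variable {S R : Type*} [CommRing S] [Algebra ℝ S] [CommRing R] [Algebra ℝ R]
  (E : LeafFrame S R)

/-- The endomorphism of the tractor bundle that is given by the action of `M` on `ℝ³ ⊕ (ℝ³)*`, in
the conformal frame. -/
def tractorAct (M : Matrix (Fin 3) (Fin 3) R) : Matrix ConfIdx ConfIdx R :=
  E.toConfFrame.Ninv * dbl M * E.frame

lemma tractorAct_add (M N : Matrix (Fin 3) (Fin 3) R) :
    E.tractorAct (M + N) = E.tractorAct M + E.tractorAct N := by
  rw [tractorAct, dbl_add, Matrix.mul_add, Matrix.add_mul]; rfl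

lemma tractorAct_sub (M N : Matrix (Fin 3) (Fin 3) R) :
    E.tractorAct (M - N) = E.tractorAct M - E.tractorAct N := by
  rw [tractorAct, dbl_sub, Matrix.mul_sub, Matrix.sub_mul]; rfl

lemma tractorAct_smul (r : R) (M : Matrix (Fin 3) (Fin 3) R) :
    E.tractorAct (r • M) = r • E.tractorAct M := by
  rw [tractorAct, dbl_smul, Matrix.mul_smul, Matrix.smul_mul]; rfl

lemma frame_mul_tractorAct (M : Matrix (Fin 3) (Fin 3) R) :
    E.frame * E.tractorAct M * E.toConfFrame.Ninv = dbl M := by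
  have h : E.frame * E.toConfFrame.Ninv = 1 := E.toConfFrame.mul_Ninv
  rw [tractorAct, Matrix.mul_assoc E.toConfFrame.Ninv, ← Matrix.mul_assoc, h, Matrix.one_mul,
    Matrix.mul_assoc, h, Matrix.mul_one]

lemma tractorAct_bracket (M N : Matrix (Fin 3) (Fin 3) R) :
    E.tractorAct M * E.tractorAct N - E.tractorAct N * E.tractorAct M
      = E.tractorAct (M * N - N * M) := by
  have h : E.frame * E.toConfFrame.Ninv = 1 := E.toConfFrame.mul_Ninv
  have h2 : ∀ M N, E.tractorAct M * E.tractorAct N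
      = E.toConfFrame.Ninv * (dbl M * dbl N) * E.frame := by
    intro M N
    rw [tractorAct, tractorAct, Matrix.mul_assoc (E.toConfFrame.Ninv * dbl M),
      ← Matrix.mul_assoc E.frame, ← Matrix.mul_assoc E.frame, h, Matrix.one_mul]
    simp only [Matrix.mul_assoc]
  rw [h2, h2, ← Matrix.sub_mul, ← Matrix.mul_sub, ← dbl_bracket, tractorAct]

/-- The matrix `E₁₃`, times `f`. -/
def corner (f : R) : Matrix (Fin 3) (Fin 3) R := !![0, 0, f; 0, 0, 0; 0, 0, 0]

lemma curvSD_bracket_curvASD (μ ν κ l : Fin 4) :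
    E.curvSD μ ν * E.curvASD κ l - E.curvASD κ l * E.curvSD μ ν
      = corner (E.sdForm μ ν * E.asdForm κ l * E.π (E.om1 * E.om2)) := by
  rw [map_mul]
  ext a b
  fin_cases a <;> fin_cases b <;>
  simp [ContactFrame.curvSD, ContactFrame.curvASD, corner]
  ring

end

variable {U : Opens (Fin 3 → ℝ)} {V : Opens (Fin 4 → ℝ)} (E : LeafFrame (smoothAlg U) (smoothAlg V))
  {o : (Fin 4 → ℝ) → ℝ} {g : (Fin 4 → ℝ) → Matrix (Fin 4) (Fin 4) ℝ}

/-- The metric `g` with orientation `o` is given by the frame `E`, and the orientation is the one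
for which `k ∧ e` is self-dual and `m ∧ k` is anti-self-dual. -/
structure Represents (E : LeafFrame (smoothAlg U) (smoothAlg V)) (o : (Fin 4 → ℝ) → ℝ)
    (g : (Fin 4 → ℝ) → Matrix (Fin 4) (Fin 4) ℝ) : Prop where
  d_eq : E.d = smoothAlg.pder
  metric_eq : ∀ q : V, g q = evalM q E.metric
  hodge_sdForm : ∀ (q : V) a b,
    hodge o g q (fun c d => (E.sdForm c d).1 q) a b = (E.sdForm a b).1 q
  hodge_asdForm : ∀ (q : V) a b,
    hodge o g q (fun c d => (E.asdForm c d).1 q) a b = -(E.asdForm a b).1 q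

namespace Represents

variable {E}

lemma hodge_combination (H : E.Represents o g) (q : V) (x y : ℝ) (a b : Fin 4) :
    hodge o g q (fun c d => x * (E.sdForm c d).1 q + y * (E.asdForm c d).1 q) a b
      = x * (E.sdForm a b).1 q - y * (E.asdForm a b).1 q := by
  rw [hodge_add, hodge_smul, hodge_smul, H.hodge_sdForm, H.hodge_asdForm]
  ring

lemma weyl_eq (H : E.Represents o g) (q : V) (a b c d : Fin 4) :
    weyl g q a b c d = E.ρ.1 q ^ 2 * (E.π E.om1).1 q * (E.sdForm a b).1 q * (E.sdForm c d).1 q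
      + E.ρ.1 q ^ 2 * (E.π E.om2).1 q * (E.asdForm a b).1 q * (E.asdForm c d).1 q := by
  have h : weyl g q a b c d = (E.ρ ^ 2 * (E.π E.om1 * (E.sdForm a b * E.sdForm c d)
      + E.π E.om2 * (E.asdForm a b * E.asdForm c d))).1 q := by
    rw [← E.lowered_curvature]
    exact E.toConfFrame.weyl_eq H.d_eq H.metric_eq E.torsionFree E.ricciFree q a b c d
  rw [h]
  simp only [← smoothAlg.eval_apply, map_mul, map_add, map_pow]
  ring

lemma hodge_weyl (H : E.Represents o g) (q : V) (a b c d : Fin 4) :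
    hodge o g q (weyl g q a b) c d
      = E.ρ.1 q ^ 2 * (E.π E.om1).1 q * (E.sdForm a b).1 q * (E.sdForm c d).1 q
      - E.ρ.1 q ^ 2 * (E.π E.om2).1 q * (E.asdForm a b).1 q * (E.asdForm c d).1 q := by
  rw [← H.hodge_combination]
  exact congrArg (fun F => hodge o g q F c d) (funext fun c => funext fun d => H.weyl_eq q a b c d)

theorem weylPlus_eq (H : E.Represents o g) (q : V) (a b c d : Fin 4) :
    weylPlus o g q a b c d
      = E.ρ.1 q ^ 2 * (E.π E.om1).1 q * (E.sdForm a b).1 q * (E.sdForm c d).1 q := by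
  rw [weylPlus, H.weyl_eq, H.hodge_weyl]
  ring

theorem weylMinus_eq (H : E.Represents o g) (q : V) (a b c d : Fin 4) :
    weylMinus o g q a b c d
      = E.ρ.1 q ^ 2 * (E.π E.om2).1 q * (E.asdForm a b).1 q * (E.asdForm c d).1 q := by
  rw [weylMinus, H.weyl_eq, H.hodge_weyl]
  ring

lemma confConn_eq (H : E.Represents o g) (q : V) (μ : Fin 4) :
    confConn g μ q = evalM q (E.toConfFrame.K μ) :=
  E.toConfFrame.confConn_eq H.d_eq H.metric_eq E.torsionFree E.ricciFree q μ

lemma confCurv_eq (H : E.Represents o g) (q : V) (μ ν : Fin 4) :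
    confCurv g μ ν q = evalM q (E.tractorAct (E.curvSD μ ν))
      + evalM q (E.tractorAct (E.curvASD μ ν)) := by
  rw [← evalM_add, ← tractorAct_add, tractorAct, ← E.curvature_tractorConn]
  exact E.toConfFrame.confCurv_eq H.d_eq H.metric_eq E.torsionFree E.ricciFree q μ ν

lemma confCurvDual_eq (H : E.Represents o g) (q : V) (μ ν : Fin 4) :
    confCurvDual o g μ ν q = evalM q (E.tractorAct (E.curvSD μ ν - E.curvASD μ ν)) := by
  have hs : ∀ κ l, evalM q (E.tractorAct (E.curvSD κ l)) = (E.sdForm κ l).1 q • evalM q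
      (E.tractorAct !![0, E.π E.om1, E.π (E.P E.om1); 0, 0, 0; 0, 0, 0]) := by
    intro κ l
    rw [ContactFrame.curvSD, tractorAct_smul, evalM_smul]
  have ha : ∀ κ l, evalM q (E.tractorAct (E.curvASD κ l)) = (E.asdForm κ l).1 q • evalM q
      (E.tractorAct !![0, 0, E.π E.om3; 0, 0, E.π E.om2; 0, 0, 0]) := by
    intro κ l
    rw [ContactFrame.curvASD, tractorAct_smul, evalM_smul]
  rw [tractorAct_sub, evalM_sub, hs, ha]
  ext A B
  simp only [confCurvDual, of_apply, Matrix.sub_apply, Matrix.smul_apply, smul_eq_mul]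
  rw [mul_comm ((E.sdForm μ ν).1 q), mul_comm ((E.asdForm μ ν).1 q), ← H.hodge_combination]
  refine congrArg (fun F => hodge o g q F μ ν) (funext fun κ => funext fun l => ?_)
  rw [H.confCurv_eq, hs, ha]
  simp only [Matrix.add_apply, Matrix.smul_apply, smul_eq_mul]
  ring

lemma confCurvPlus_eq (H : E.Represents o g) (q : V) (μ ν : Fin 4) :
    confCurvPlus o g μ ν q = evalM q (E.tractorAct (E.curvSD μ ν)) := by
  rw [confCurvPlus, H.confCurv_eq, H.confCurvDual_eq, tractorAct_sub, evalM_sub]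
  module

lemma confCurvMinus_eq (H : E.Represents o g) (q : V) (μ ν : Fin 4) :
    confCurvMinus o g μ ν q = evalM q (E.tractorAct (E.curvASD μ ν)) := by
  rw [confCurvMinus, H.confCurv_eq, H.confCurvDual_eq, tractorAct_sub, evalM_sub]
  module

lemma commutator_eq (H : E.Represents o g) (q : V) (μ ν κ l : Fin 4) :
    confCurvPlus o g μ ν q * confCurvMinus o g κ l q
        - confCurvMinus o g κ l q * confCurvPlus o g μ ν q
      = evalM q (E.tractorAct (corner (E.sdForm μ ν * E.asdForm κ l * E.π (E.om1 * E.om2)))) := by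
  rw [H.confCurvPlus_eq, H.confCurvMinus_eq, ← evalM_mul, ← evalM_mul, ← evalM_sub,
    tractorAct_bracket, curvSD_bracket_curvASD]

lemma yangMillsTerm_eq (H : E.Represents o g) (q : V) (κ μ ν : Fin 4) :
    yangMillsTerm o g κ μ ν q = evalM q (E.toConfFrame.Ninv *
      ((dbl (E.curvSD μ ν - E.curvASD μ ν)).map (E.d κ)
        + (E.tractorConn κ * dbl (E.curvSD μ ν - E.curvASD μ ν)
          - dbl (E.curvSD μ ν - E.curvASD μ ν) * E.tractorConn κ)) * E.frame) := by
  have h := E.toConfFrame.covariant_deriv_conj κ (dbl (E.curvSD μ ν - E.curvASD μ ν))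
  refine Eq.trans ?_ (congrArg (evalM q) h)
  rw [yangMillsTerm, ConfFrame.pdMat_eq (H.confCurvDual_eq · μ ν), H.confConn_eq, H.confCurvDual_eq,
    evalM_add, evalM_sub, evalM_mul, evalM_mul]
  have hd : smoothAlg.pder κ = E.toConfFrame.d κ := by rw [← H.d_eq]; rfl
  rw [hd]
  rfl

/-- The Bach tensor is a multiple of `∂_p² w₁`. -/
theorem yangMills_eq (H : E.Represents o g) (q : V) (κ μ ν : Fin 4) :
    yangMills o g κ μ ν q = evalM q (E.tractorAct
      ((2 * E.contactVol κ μ ν) • corner (E.π (E.P (E.P E.om1))))) := by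
  rw [yangMills, H.yangMillsTerm_eq, H.yangMillsTerm_eq, H.yangMillsTerm_eq, ← evalM_add,
    ← evalM_add, ← Matrix.add_mul, ← Matrix.add_mul, ← Matrix.mul_add, ← Matrix.mul_add]
  exact congrArg (fun X => evalM q (E.toConfFrame.Ninv * X * E.frame))
    (E.yangMills_tractorConn κ μ ν)

lemma evalM_tractorAct_corner_zero (q : V) (r : smoothAlg V) :
    evalM q (E.tractorAct (r • corner (E.π 0))) = 0 := by
  have h : corner (E.π 0) = 0 := by
    rw [map_zero]
    ext a b
    fin_cases a <;> fin_cases b <;> rfl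
  rw [h, smul_zero, tractorAct, dbl]
  simp [evalM_zero]

theorem bastonMason_of_mul_eq_zero (H : E.Represents o g) (h : E.om1 * E.om2 = 0) :
    BastonMason o g V := by
  constructor
  · intro x hx κ μ ν
    rw [H.yangMills_eq ⟨x, hx⟩, E.P_P_om1_eq_zero h]
    exact evalM_tractorAct_corner_zero _ _
  · intro x hx μ ν κ l
    have h1 : corner (E.sdForm μ ν * E.asdForm κ l * E.π 0)
        = (E.sdForm μ ν * E.asdForm κ l) • corner (E.π 0) := by
      rw [map_zero]
      ext a b
      fin_cases a <;> fin_cases b <;> simp [corner]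
    rw [H.commutator_eq ⟨x, hx⟩, h, h1]
    exact evalM_tractorAct_corner_zero _ _

theorem mul_eq_zero_of_bastonMason (H : E.Represents o g) (h : BastonMason o g V) (q : V) :
    (E.π (E.om1 * E.om2)).1 q = 0 := by
  -- `k ∧ e` has the component `1` along `dy ∧ dx`, and `m ∧ k` along `dp ∧ dy`
  have h1 := h.commutator_eq_zero q q.2 1 0 2 1
  have hone : E.sdForm 1 0 * E.asdForm 2 1 = 1 := by
    simp [ContactFrame.sdForm, ContactFrame.asdForm, E.k_eq, E.e_eq, E.m_eq]
  rw [H.commutator_eq, hone, one_mul] at h1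
  have h2 := congrArg (evalM q) (E.frame_mul_tractorAct (corner (E.π (E.om1 * E.om2))))
  rw [evalM_mul, evalM_mul, h1, Matrix.mul_zero, Matrix.zero_mul] at h2
  exact (congrFun (congrFun h2 (.inl 0)) (.inl 2)).symm

end Represents

end LeafFrame

/-! ### The null tetrad and the curvature functions -/

lemma feffermanMetric_eq_tetrad (i : ℝ) (Q : (Fin 3 → ℝ) → ℝ) (s : (Fin 4 → ℝ) → (Fin 8 → ℝ))
    (q : Fin 4 → ℝ) : feffermanMetric i Q s q
      = (leafTetrad i Q s q)ᵀ * nullGram * leafTetrad i Q s q := by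
  ext μ ν
  simp only [feffermanMetric, of_apply, bilinG_eq_tetrad]
  simp [mul_apply, Fin.sum_univ_four, nullGram, leafTetrad, tetrad]
  ring

lemma curvR_eq_zero_iff {i : ℝ} (hi : i ≠ 0) (Q : (Fin 3 → ℝ) → ℝ) {U : Set (Fin 3 → ℝ)}
    {z : Fin 8 → ℝ} (hz : z ∈ bundle U) : curvR i Q z = 0 ↔ w₁ Q (base z) = 0 := by
  have h3 : z 3 ≠ 0 := hz.2
  simp [curvR, hi, h3, Real.exp_ne_zero]

lemma curvRbar_eq_zero_iff {i : ℝ} (hi : i ≠ 0) (Q : (Fin 3 → ℝ) → ℝ) {U : Set (Fin 3 → ℝ)}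
    {z : Fin 8 → ℝ} (hz : z ∈ bundle U) : curvRbar i Q z = 0 ↔ w₂ Q (base z) = 0 := by
  have h3 : z 3 ≠ 0 := hz.2
  simp [curvRbar, hi, h3, Real.exp_ne_zero]

lemma exists_mem_bundle {U : Set (Fin 3 → ℝ)} {u : Fin 3 → ℝ} (hu : u ∈ U) :
    ∃ z ∈ bundle U, base z = u := by
  have h : base ![u 0, u 1, u 2, 1, 0, 0, 0, 0] = u := by
    ext k; fin_cases k <;> rfl
  exact ⟨_, ⟨by rwa [h], one_ne_zero⟩, h⟩

lemma forall_bundle_iff {i : ℝ} (hi : i ≠ 0) (Q : (Fin 3 → ℝ) → ℝ) (U : Set (Fin 3 → ℝ)) :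
    ((∀ z ∈ bundle U, curvR i Q z = 0) ↔ ∀ u ∈ U, w₁ Q u = 0) ∧
    ((∀ z ∈ bundle U, curvRbar i Q z = 0) ↔ ∀ u ∈ U, w₂ Q u = 0) := by
  refine ⟨⟨fun h u hu => ?_, fun h z hz => (curvR_eq_zero_iff hi Q hz).2 (h _ hz.1)⟩,
    ⟨fun h u hu => ?_, fun h z hz => (curvRbar_eq_zero_iff hi Q hz).2 (h _ hz.1)⟩⟩
  · obtain ⟨z, hz, rfl⟩ := exists_mem_bundle hu
    exact (curvR_eq_zero_iff hi Q hz).1 (h z hz)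
  · obtain ⟨z, hz, rfl⟩ := exists_mem_bundle hu
    exact (curvRbar_eq_zero_iff hi Q hz).1 (h z hz)

lemma forall_bundle_or_iff {i : ℝ} (hi : i ≠ 0) (Q : (Fin 3 → ℝ) → ℝ) (U : Set (Fin 3 → ℝ)) :
    (∀ z ∈ bundle U, curvR i Q z = 0 ∨ curvRbar i Q z = 0) ↔ ∀ u ∈ U, w₁ Q u * w₂ Q u = 0 := by
  constructor
  · intro h u hu
    obtain ⟨z, hz, rfl⟩ := exists_mem_bundle hu
    rw [mul_eq_zero, ← curvR_eq_zero_iff hi Q hz, ← curvRbar_eq_zero_iff hi Q hz]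
    exact h z hz
  · intro h z hz
    rw [curvR_eq_zero_iff hi Q hz, curvRbar_eq_zero_iff hi Q hz, ← mul_eq_zero]
    exact h _ hz.1

/-! ### Analyticity of the relative invariants -/

lemma analyticOnNhd_pd {n : ℕ} {U : Set (Fin n → ℝ)} {F : (Fin n → ℝ) → ℝ}
    (hF : AnalyticOnNhd ℝ F U) (μ : Fin n) : AnalyticOnNhd ℝ (pd μ F) U :=
  (ContinuousLinearMap.apply ℝ ℝ (Pi.single μ 1 : Fin n → ℝ)).comp_analyticOnNhd hF.fderiv

lemma analyticOnNhd_coord {n : ℕ} (U : Set (Fin n → ℝ)) (k : Fin n) :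
    AnalyticOnNhd ℝ (fun u => u k) U := fun x _ =>
  (ContinuousLinearMap.proj (R := ℝ) (φ := fun _ : Fin n => ℝ) k).analyticAt x

lemma analyticOnNhd_totalD {U : Set (Fin 3 → ℝ)} {Q F : (Fin 3 → ℝ) → ℝ}
    (hQ : AnalyticOnNhd ℝ Q U) (hF : AnalyticOnNhd ℝ F U) : AnalyticOnNhd ℝ (totalD Q F) U :=
  ((analyticOnNhd_pd hF 0).add ((analyticOnNhd_coord U 2).mul (analyticOnNhd_pd hF 1))).add
    (hQ.mul (analyticOnNhd_pd hF 2))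

lemma analyticOnNhd_w₁ {U : Set (Fin 3 → ℝ)} {Q : (Fin 3 → ℝ) → ℝ}
    (hQ : AnalyticOnNhd ℝ Q U) : AnalyticOnNhd ℝ (w₁ Q) U := by
  have hp := analyticOnNhd_pd hQ 2
  have hy := analyticOnNhd_pd hQ 1
  have hpp := analyticOnNhd_pd hp 2
  have hyp := analyticOnNhd_pd hp 1
  have hyy := analyticOnNhd_pd hy 1
  have hDpp := analyticOnNhd_totalD hQ hpp
  have hc : ∀ c : ℝ, AnalyticOnNhd ℝ (fun _ : Fin 3 → ℝ => c) U := fun c => analyticOnNhd_const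
  exact (((((analyticOnNhd_totalD hQ hDpp).sub ((hc 4).mul (analyticOnNhd_totalD hQ hyp))).sub
    (hDpp.mul hp)).add (((hc 4).mul hp).mul hyp)).sub (((hc 3).mul hpp).mul hy)).add
    ((hc 6).mul hyy)

lemma analyticOnNhd_w₂ {U : Set (Fin 3 → ℝ)} {Q : (Fin 3 → ℝ) → ℝ}
    (hQ : AnalyticOnNhd ℝ Q U) : AnalyticOnNhd ℝ (w₂ Q) U :=
  analyticOnNhd_pd (analyticOnNhd_pd (analyticOnNhd_pd (analyticOnNhd_pd hQ 2) 2) 2) 2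

lemma eq_zero_or_eq_zero_of_mul {n : ℕ} {U : Set (Fin n → ℝ)} (hU : IsOpen U)
    (hc : IsPreconnected U) {F G : (Fin n → ℝ) → ℝ} (hF : AnalyticOnNhd ℝ F U)
    (hG : AnalyticOnNhd ℝ G U) (h : ∀ u ∈ U, F u * G u = 0) :
    (∀ u ∈ U, F u = 0) ∨ ∀ u ∈ U, G u = 0 := by
  by_contra! hne
  obtain ⟨⟨u, hu, hFu⟩, v, hv, hGv⟩ := hne
  refine hGv (hG.eqOn_zero_of_preconnected_of_eventuallyEq_zero hc hu ?_ hv)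
  filter_upwards [(hF u hu).continuousAt.eventually_ne hFu, hU.mem_nhds hu] with x hx hxU
  exact (mul_eq_zero.1 (h x hxU)).resolve_left hx

/-! ### Curvature of a Fefferman metric -/

section FramedSection

open smoothAlg

variable {i : ℝ} (hi : i ≠ 0) {U : Set (Fin 3 → ℝ)} (hU : IsOpen U) {Q : (Fin 3 → ℝ) → ℝ}
  (hQ : ContDiffOn ℝ ∞ Q U) {V : Set (Fin 4 → ℝ)} {s : (Fin 4 → ℝ) → (Fin 8 → ℝ)}
  (hs : IsLeafSection U V s) (q : (⟨V, hs.isOpen⟩ : Opens (Fin 4 → ℝ)))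

lemma feffermanMetric_eq : feffermanMetric i Q s q = evalM q (sectionFrame hi hU hQ hs).metric := by
  ext μ ν
  have hρ : s q 3 ≠ 0 := (hs.mem_bundle q q.2).2
  obtain ⟨a0, a1, a2, a4⟩ := fderiv_section hs q.2 (Pi.single μ 1)
  obtain ⟨b0, b1, b2, b4⟩ := fderiv_section hs q.2 (Pi.single ν 1)
  have h : (evalM q (sectionFrame hi hU hQ hs).metric) μ ν
      = (sectionFrame hi hU hQ hs).ρ.1 q ^ 2
        * (((sectionFrame hi hU hQ hs).m μ).1 q * ((sectionFrame hi hU hQ hs).e ν).1 q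
          + ((sectionFrame hi hU hQ hs).e μ).1 q * ((sectionFrame hi hU hQ hs).m ν).1 q
          + 2 * (((sectionFrame hi hU hQ hs).k μ).1 q * ((sectionFrame hi hU hQ hs).be ν).1 q
            + ((sectionFrame hi hU hQ hs).be μ).1 q * ((sectionFrame hi hU hQ hs).k ν).1 q)) := rfl
  rw [h]
  simp only [feffermanMetric, of_apply, bilinG_eq hi Q hρ, sectionFrame_ρ, sectionFrame_m,
    sectionFrame_e, sectionFrame_k, sectionFrame_be, base_section hs q.2,
    (section_apply hs q.2).2.2.1, a0, a1, a2, a4, b0, b1, b2, b4]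

lemma isUnit_det_leafTetrad (hi : i ≠ 0) (hU : IsOpen U) (hQ : ContDiffOn ℝ ∞ Q U)
    (hs : IsLeafSection U V s)
    (q : (⟨V, hs.isOpen⟩ : Opens (Fin 4 → ℝ))) : IsUnit (leafTetrad i Q s q).det := by
  have h := isUnit_det_evalM q (sectionFrame hi hU hQ hs).isUnit_det_metric
  rw [← feffermanMetric_eq, det_metric (feffermanMetric_eq_tetrad i Q s q)] at h
  exact (isUnit_pow_iff two_ne_zero).1 h

lemma sdForm_apply (a b : Fin 4) : ((sectionFrame hi hU hQ hs).sdForm a b).1 q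
    = ((sectionFrame hi hU hQ hs).k a).1 q * ((sectionFrame hi hU hQ hs).e b).1 q
      - ((sectionFrame hi hU hQ hs).k b).1 q * ((sectionFrame hi hU hQ hs).e a).1 q := rfl

lemma asdForm_apply (a b : Fin 4) : ((sectionFrame hi hU hQ hs).asdForm a b).1 q
    = ((sectionFrame hi hU hQ hs).m a).1 q * ((sectionFrame hi hU hQ hs).k b).1 q
      - ((sectionFrame hi hU hQ hs).m b).1 q * ((sectionFrame hi hU hQ hs).k a).1 q := rfl

lemma wedge_theta3_theta2 (a b : Fin 4) :
    wedge (leafTetrad i Q s q 2) (leafTetrad i Q s q 1) a b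
      = -i * s q 3 ^ 3 * Real.exp (-(i * s q 4))
        * ((sectionFrame hi hU hQ hs).sdForm a b).1 q := by
  obtain ⟨a0, a1, -, -⟩ := fderiv_section hs q.2 (Pi.single a 1)
  obtain ⟨b0, b1, -, -⟩ := fderiv_section hs q.2 (Pi.single b 1)
  have h2 : ∀ a, leafTetrad i Q s q 2 a = theta3 i (s q) (fderiv ℝ s q (Pi.single a 1)) :=
    fun a => rfl
  have h1 : ∀ a, leafTetrad i Q s q 1 a = theta2 i (s q) (fderiv ℝ s q (Pi.single a 1)) :=
    fun a => rfl
  simp only [wedge, h1, h2, theta2_apply, theta3_apply, sdForm_apply, sectionFrame_k,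
    sectionFrame_e, (section_apply hs q.2).2.2.1, a0, a1, b0, b1]
  ring

lemma wedge_theta3_theta1 (a b : Fin 4) :
    wedge (leafTetrad i Q s q 2) (leafTetrad i Q s q 0) a b
      = i * s q 3 ^ 3 * Real.exp (i * s q 4)
        * ((sectionFrame hi hU hQ hs).asdForm a b).1 q := by
  obtain ⟨a0, a1, a2, -⟩ := fderiv_section hs q.2 (Pi.single a 1)
  obtain ⟨b0, b1, b2, -⟩ := fderiv_section hs q.2 (Pi.single b 1)
  have h2 : ∀ a, leafTetrad i Q s q 2 a = theta3 i (s q) (fderiv ℝ s q (Pi.single a 1)) :=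
    fun a => rfl
  have h1 : ∀ a, leafTetrad i Q s q 0 a = theta1 i Q (s q) (fderiv ℝ s q (Pi.single a 1)) :=
    fun a => rfl
  simp only [wedge, h1, h2, theta1_apply, theta3_apply, asdForm_apply, sectionFrame_k,
    sectionFrame_m, base_section hs q.2, (section_apply hs q.2).2.2.1, a0, a1, a2, b0, b1, b2]
  ring

lemma sectionFrame_represents : (sectionFrame hi hU hQ hs).Represents (leafOrientation i Q s)
    (feffermanMetric i Q s) where
  d_eq := rfl
  metric_eq := feffermanMetric_eq hi hU hQ hs
  hodge_sdForm q a b := by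
    have hρ : s q 3 ≠ 0 := (hs.mem_bundle q q.2).2
    have hc : -i * s q 3 ^ 3 * Real.exp (-(i * s q 4)) ≠ 0 :=
      mul_ne_zero (mul_ne_zero (neg_ne_zero.2 hi) (pow_ne_zero _ hρ)) (Real.exp_ne_zero _)
    have h := hodge_selfDual (o := leafOrientation i Q s) (isUnit_det_leafTetrad hi hU hQ hs q)
      (feffermanMetric_eq_tetrad i Q s q) rfl a b
    rw [wedge_theta3_theta2 hi hU hQ hs, funext fun a => funext fun b =>
      wedge_theta3_theta2 hi hU hQ hs q a b, hodge_smul] at h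
    exact mul_left_cancel₀ hc h
  hodge_asdForm q a b := by
    have hρ : s q 3 ≠ 0 := (hs.mem_bundle q q.2).2
    have hc : i * s q 3 ^ 3 * Real.exp (i * s q 4) ≠ 0 :=
      mul_ne_zero (mul_ne_zero hi (pow_ne_zero _ hρ)) (Real.exp_ne_zero _)
    have h := hodge_antiSelfDual (o := leafOrientation i Q s) (isUnit_det_leafTetrad hi hU hQ hs q)
      (feffermanMetric_eq_tetrad i Q s q) rfl a b
    rw [wedge_theta3_theta1 hi hU hQ hs, funext fun a => funext fun b =>
      wedge_theta3_theta1 hi hU hQ hs q a b, hodge_smul, ← mul_neg] at h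
    exact mul_left_cancel₀ hc h

lemma π_apply (f : smoothAlg (⟨U, hU⟩ : Opens (Fin 3 → ℝ))) :
    ((sectionFrame hi hU hQ hs).π f).1 q = f.1 ⟨jetProj q, jetProj_mem hs q.2⟩ := rfl

lemma weylPlus_feffermanMetric (hi : i ≠ 0) (hU : IsOpen U) (hQ : ContDiffOn ℝ ∞ Q U)
    (hs : IsLeafSection U V s)
    (q : (⟨V, hs.isOpen⟩ : Opens (Fin 4 → ℝ))) (a b c d : Fin 4) :
    weylPlus (leafOrientation i Q s) (feffermanMetric i Q s) q a b c d = -curvR i Q (s q)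
      * (wedge (leafTetrad i Q s q 2) (leafTetrad i Q s q 1) a b
        * wedge (leafTetrad i Q s q 2) (leafTetrad i Q s q 1) c d) := by
  have hρ : s q 3 ≠ 0 := (hs.mem_bundle q q.2).2
  rw [(sectionFrame_represents hi hU hQ hs).weylPlus_eq, wedge_theta3_theta2 hi hU hQ hs,
    wedge_theta3_theta2 hi hU hQ hs, sectionFrame_ρ, π_apply, sectionFrame_om1, curvR,
    base_section hs q.2, show 2 * i * s q 4 = i * s q 4 + i * s q 4 by ring, Real.exp_add,
    Real.exp_neg]
  field_simp

lemma weylMinus_feffermanMetric (hi : i ≠ 0) (hU : IsOpen U) (hQ : ContDiffOn ℝ ∞ Q U)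
    (hs : IsLeafSection U V s)
    (q : (⟨V, hs.isOpen⟩ : Opens (Fin 4 → ℝ))) (a b c d : Fin 4) :
    weylMinus (leafOrientation i Q s) (feffermanMetric i Q s) q a b c d = -curvRbar i Q (s q)
      * (wedge (leafTetrad i Q s q 2) (leafTetrad i Q s q 0) a b
        * wedge (leafTetrad i Q s q 2) (leafTetrad i Q s q 0) c d) := by
  have hρ : s q 3 ≠ 0 := (hs.mem_bundle q q.2).2
  rw [(sectionFrame_represents hi hU hQ hs).weylMinus_eq, wedge_theta3_theta1 hi hU hQ hs,
    wedge_theta3_theta1 hi hU hQ hs, sectionFrame_ρ, π_apply, sectionFrame_om2, curvRbar,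
    base_section hs q.2, show -(2 * i * s q 4) = -(i * s q 4 + i * s q 4) by ring, Real.exp_neg,
    Real.exp_add]
  field_simp

theorem bastonMason_iff (hi : i ≠ 0) (hU : IsOpen U) (hQ : ContDiffOn ℝ ∞ Q U)
    (hs : IsLeafSection U V s) :
    BastonMason (leafOrientation i Q s) (feffermanMetric i Q s) V
    ↔ ∀ u ∈ U, w₁ Q u * w₂ Q u = 0 := by
  have H := sectionFrame_represents hi hU hQ hs
  have hmul : ∀ u : (⟨U, hU⟩ : Opens (Fin 3 → ℝ)),
      ((sectionFrame hi hU hQ hs).om1 * (sectionFrame hi hU hQ hs).om2).1 u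
        = w₁ Q u * w₂ Q u / 36 := by
    intro u
    change (sectionFrame hi hU hQ hs).om1.1 u * (sectionFrame hi hU hQ hs).om2.1 u = _
    rw [sectionFrame_om1, sectionFrame_om2]
    ring
  constructor
  · intro h u hu
    obtain ⟨y, hy, rfl⟩ := hs.surj u hu
    have h1 := H.mul_eq_zero_of_bastonMason h ⟨y, hy⟩
    rw [π_apply, hmul] at h1
    rw [base_section hs hy]
    linarith
  · intro h
    refine H.bastonMason_of_mul_eq_zero ?_
    ext u
    rw [hmul, h u u.2, zero_div]
    rfl

end FramedSection

end FeffermanODE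

end

theorem proposition1
    (i : ℝ) (hi : i ≠ 0)
    (U : Set (Fin 3 → ℝ)) (hU : IsOpen U)
    (Q : (Fin 3 → ℝ) → ℝ) (hQ : ContDiffOn ℝ ∞ Q U)
    (V : Set (Fin 4 → ℝ)) (s : (Fin 4 → ℝ) → (Fin 8 → ℝ)) (hs : IsLeafSection U V s)
    (g : (Fin 4 → ℝ) → Matrix (Fin 4) (Fin 4) ℝ) (hg : g = feffermanMetric i Q s)
    (o : (Fin 4 → ℝ) → ℝ) (ho : o = leafOrientation i Q s)
    (θ : (Fin 4 → ℝ) → Matrix (Fin 4) (Fin 4) ℝ) (hθ : θ = leafTetrad i Q s) :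
    -- `g` is a metric of signature `(++--)`
    (∀ q ∈ V, (g q).IsSymm ∧ sigPos (g q).toQuadraticForm' = 2 ∧
      sigNeg (g q).toQuadraticForm' = 2) ∧
    -- `C⁺ = -R (θ³ ∧ θ²) ⊗ (θ³ ∧ θ²)` and `C⁻ = -R̄ (θ³ ∧ θ¹) ⊗ (θ³ ∧ θ¹)`
    (∀ q ∈ V, ∀ a b c d, weylPlus o g q a b c d =
      -curvR i Q (s q) * (wedge (θ q 2) (θ q 1) a b * wedge (θ q 2) (θ q 1) c d)) ∧
    (∀ q ∈ V, ∀ a b c d, weylMinus o g q a b c d =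
      -curvRbar i Q (s q) * (wedge (θ q 2) (θ q 0) a b * wedge (θ q 2) (θ q 0) c d)) ∧
    -- each of them is of type N where it does not vanish
    (∀ q ∈ V, curvR i Q (s q) ≠ 0 → IsTypeN (g q) (weylPlus o g q)) ∧
    (∀ q ∈ V, curvRbar i Q (s q) ≠ 0 → IsTypeN (g q) (weylMinus o g q)) ∧
    -- `R` vanishes where `w₁` does, and `R̄` vanishes where `w₂` does
    (∀ z ∈ bundle U, (curvR i Q z = 0 ↔ w₁ Q (base z) = 0) ∧
      (curvRbar i Q z = 0 ↔ w₂ Q (base z) = 0)) ∧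
    -- the Baston–Mason conditions, pointwise and for the whole equation
    (BastonMason o g V ↔ ∀ z ∈ bundle U, curvR i Q z = 0 ∨ curvRbar i Q z = 0) ∧
    ((AnalyticOnNhd ℝ Q U ∧ IsPreconnected U) ∨
        (((∀ z ∈ bundle U, curvR i Q z = 0) ∨ (∀ z ∈ bundle U, curvR i Q z ≠ 0)) ∧
          ((∀ z ∈ bundle U, curvRbar i Q z = 0) ∨ (∀ z ∈ bundle U, curvRbar i Q z ≠ 0))) →
      (BastonMason o g V ↔
        (∀ z ∈ bundle U, curvR i Q z = 0) ∨ (∀ z ∈ bundle U, curvRbar i Q z = 0))) := by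
  subst hg ho hθ
  have hdet : ∀ q ∈ V, IsUnit (leafTetrad i Q s q).det := fun q hq =>
    isUnit_det_leafTetrad hi hU hQ hs ⟨q, hq⟩
  have hplus := fun q (hq : q ∈ V) => weylPlus_feffermanMetric hi hU hQ hs ⟨q, hq⟩
  have hminus := fun q (hq : q ∈ V) => weylMinus_feffermanMetric hi hU hQ hs ⟨q, hq⟩
  have hBM := (bastonMason_iff hi hU hQ hs).trans (forall_bundle_or_iff hi Q U).symm
  refine ⟨fun q hq => signature_of_nullTetrad (hdet q hq) (feffermanMetric_eq_tetrad i Q s q),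
    hplus, hminus, fun q hq hR => ?_, fun q hq hR => ?_,
    fun z hz => ⟨curvR_eq_zero_iff hi Q hz, curvRbar_eq_zero_iff hi Q hz⟩, hBM, fun hreg => ?_⟩
  · rw [funext fun a => funext fun b => funext fun c => funext fun d => hplus q hq a b c d]
    have key := dotProduct_inv_mulVec (hdet q hq) (feffermanMetric_eq_tetrad i Q s q)
    exact isTypeN_of_null (neg_ne_zero.2 hR) (exists_wedge_ne_zero (hdet q hq) (by decide))
      (key 2 2) (key 2 1) (key 1 2)
  · rw [funext fun a => funext fun b => funext fun c => funext fun d => hminus q hq a b c d]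
    have key := dotProduct_inv_mulVec (hdet q hq) (feffermanMetric_eq_tetrad i Q s q)
    exact isTypeN_of_null (neg_ne_zero.2 hR) (exists_wedge_ne_zero (hdet q hq) (by decide))
      (key 2 2) (key 2 0) (key 0 2)
  · constructor
    · intro h
      rcases hreg with ⟨hQa, hc⟩ | ⟨hR | hR, hR'⟩
      · rw [(forall_bundle_iff hi Q U).1, (forall_bundle_iff hi Q U).2]
        exact eq_zero_or_eq_zero_of_mul hU hc (analyticOnNhd_w₁ hQa) (analyticOnNhd_w₂ hQa)
          ((forall_bundle_or_iff hi Q U).1 (hBM.1 h))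
      · exact Or.inl hR
      · exact Or.inr fun z hz => (hBM.1 h z hz).resolve_left (hR z hz)
    · rintro (h | h)
      · exact hBM.2 fun z hz => Or.inl (h z hz)
      · exact hBM.2 fun z hz => Or.inr (h z hz)
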